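/- Let $n\ge 3$, $\beta := 2/(n-2)$, and let $R\in\mathbb{R}$, $C>0$, $\nu>0$ and functions $b,c:\mathbb{R}^n\to\mathbb{R}$ be given. Then there is a sequence $(\alpha_k)_{k\in\mathbb{N}}$ of real numbers with $\alpha_k\to 0$ as $k\to\infty$, depending only on $R$, $C$, $\nu$, $b$ and $c$ (and on the dimension $n$), such that the following holds. Let $F:\mathbb{R}^n\times\mathbb{R}\to\mathbb{R}$ be continuous, with $F(x,\cdot)$ continuously differentiable for every $x\in\mathbb{R}^n$, and assume $$F(\cdot,0)\in L^2(\mathbb{R}^n),\qquad |F'_u(x,u)|\le C(1+|u|^\beta)\quad\text{for all }(x,u)\in\mathbb{R}^n\times\mathbb{R},\tag{1.3}$$ $$F(x,u)\,u\le -\nu|u|^2+b(x)|u|^q+c(x)\quad\text{for a.e. }x\in\mathbb{R}^n\text{ and all }u\in\mathbb{R},\tag{2.1}$$ where $c\in L^1(\mathbb{R}^n)$, $2\le q<2n/(n-2)$, and $b\in L^p(\mathbb{R}^n)$ with $2n/[2n-q(n-2)]\le p<\infty$. Let $u:[0,T]\to H^1(\mathbb{R}^n)$ be a solution of $\dot u+Au=\hat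 F(u)$, where $A=-\Delta$ on $L^2(\mathbb{R}^n)$ with domain $H^2(\mathbb{R}^n)$ and $\hat F(u)(x)=F(x,u(x))$; that is, $u$ is continuous from $[0,T]$ to $H^1(\mathbb{R}^n)$ and, for every $t\in(0,T)$, $u$ is differentiable at $t$ as an $L^2(\mathbb{R}^n)$-valued map, $u(t)\in H^2(\mathbb{R}^n)$, and $\dot u(t)-\Delta u(t)=\hat F(u(t))$ in $L^2(\mathbb{R}^n)$. Suppose that $\|u(t)\|_{H^1}\le R$ for all $t\in[0,T]$, where $\|v\|_{H^1}^2=\|v\|_{L^2}^2+\|\nabla v\|_{L^2}^2$. Then $$\int_{|x|\ge k}|u(t,x)|^2\,dx\le R^2e^{-2\nu t}+\alpha_k\qquad\text{for all }t\in[0,T]\text{ and all }k\in\mathbb{N}.$$ -/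

import Mathlib

open MeasureTheory Filter Topology Set
open scoped ContDiff ENNReal

noncomputable section

/-- The real Hilbert space `L²(ℝⁿ)`. -/
abbrev L2 (n : ℕ) : Type := Lp ℝ 2 (volume : Measure (EuclideanSpace ℝ (Fin n)))

/-- `v` is the weak partial derivative `∂u/∂xᵢ` on `ℝⁿ` (for `u`, `v` in `L²`). -/
def HasWeakPartial {n : ℕ} (i : Fin n) (u v : L2 n) : Prop :=
  ∀ φ : EuclideanSpace ℝ (Fin n) → ℝ, ContDiff ℝ ∞ φ → HasCompactSupport φ →
    ∫ x, u x * fderiv ℝ φ x (EuclideanSpace.single i 1) = - ∫ x, v x * φ x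

theorem integrable_L2_mul {n : ℕ} (u : L2 n) {g : EuclideanSpace ℝ (Fin n) → ℝ}
    (hg : Continuous g) (hs : HasCompactSupport g) : Integrable (fun x => u x * g x) :=
  (Lp.memLp u).integrable_mul (p := 2) (q := 2) (hg.memLp_of_hasCompactSupport hs)

theorem integrable_L2_mul_partial {n : ℕ} (i : Fin n) (u : L2 n)
    {φ : EuclideanSpace ℝ (Fin n) → ℝ} (hφ : ContDiff ℝ ∞ φ) (hs : HasCompactSupport φ) :
    Integrable (fun x => u x * fderiv ℝ φ x (EuclideanSpace.single i 1)) := by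
  refine integrable_L2_mul u ?_ (hs.fderiv_apply (𝕜 := ℝ) _)
  exact (hφ.continuous_fderiv (by simp)).clm_apply continuous_const

theorem HasWeakPartial.add {n : ℕ} {i : Fin n} {u₁ u₂ v₁ v₂ : L2 n}
    (h₁ : HasWeakPartial i u₁ v₁) (h₂ : HasWeakPartial i u₂ v₂) :
    HasWeakPartial i (u₁ + u₂) (v₁ + v₂) := by
  intro φ hφ hs
  have e₁ : ∫ x, (u₁ + u₂ : L2 n) x * fderiv ℝ φ x (EuclideanSpace.single i 1) =
      ∫ x, (u₁ x * fderiv ℝ φ x (EuclideanSpace.single i 1) +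
        u₂ x * fderiv ℝ φ x (EuclideanSpace.single i 1)) := by
    apply integral_congr_ae
    filter_upwards [Lp.coeFn_add u₁ u₂] with x hx
    rw [hx, Pi.add_apply, add_mul]
  have e₂ : ∫ x, (v₁ + v₂ : L2 n) x * φ x = ∫ x, (v₁ x * φ x + v₂ x * φ x) := by
    apply integral_congr_ae
    filter_upwards [Lp.coeFn_add v₁ v₂] with x hx
    rw [hx, Pi.add_apply, add_mul]
  rw [e₁, e₂, integral_add (integrable_L2_mul_partial i u₁ hφ hs)
    (integrable_L2_mul_partial i u₂ hφ hs), integral_add (integrable_L2_mul v₁ hφ.continuous hs)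
    (integrable_L2_mul v₂ hφ.continuous hs), h₁ φ hφ hs, h₂ φ hφ hs]
  ring

theorem HasWeakPartial.smul {n : ℕ} {i : Fin n} {u v : L2 n} (a : ℝ)
    (h : HasWeakPartial i u v) : HasWeakPartial i (a • u) (a • v) := by
  intro φ hφ hs
  have e₁ : ∫ x, (a • u : L2 n) x * fderiv ℝ φ x (EuclideanSpace.single i 1) =
      ∫ x, a * (u x * fderiv ℝ φ x (EuclideanSpace.single i 1)) := by
    apply integral_congr_ae
    filter_upwards [Lp.coeFn_smul a u] with x hx
    rw [hx, Pi.smul_apply, smul_eq_mul, mul_assoc]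
  have e₂ : ∫ x, (a • v : L2 n) x * φ x = ∫ x, a * (v x * φ x) := by
    apply integral_congr_ae
    filter_upwards [Lp.coeFn_smul a v] with x hx
    rw [hx, Pi.smul_apply, smul_eq_mul, mul_assoc]
  rw [e₁, e₂, integral_const_mul, integral_const_mul, h φ hφ hs]
  ring

theorem HasWeakPartial.zero {n : ℕ} (i : Fin n) : HasWeakPartial i (0 : L2 n) 0 := by
  have h (g : EuclideanSpace ℝ (Fin n) → ℝ) : ∫ x, (0 : L2 n) x * g x = 0 := by
    rw [integral_eq_zero_of_ae]
    filter_upwards [Lp.coeFn_zero ℝ 2 (volume : Measure (EuclideanSpace ℝ (Fin n)))] with x hx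
    rw [hx, Pi.zero_apply, zero_mul]
  intro φ _ _
  rw [h, h, neg_zero]

/-- The Sobolev space `H¹(ℝⁿ)`, realized as the graph `{(u, ∇u)}` of the weak gradient in
`L²(ℝⁿ) × L²(ℝⁿ)ⁿ` (the weak gradient of `u` is unique). The norm inherited from the Hilbert sum is
`‖u‖_{H¹} = (‖u‖²_{L²} + ∑ᵢ ‖∂ᵢu‖²_{L²})^{1/2}`. -/
def H1Submodule (n : ℕ) : Submodule ℝ (WithLp 2 (L2 n × PiLp 2 (fun _ : Fin n => L2 n))) where
  carrier := {w | ∀ i, HasWeakPartial i w.fst (w.snd i)}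
  add_mem' := fun h₁ h₂ i => (h₁ i).add (h₂ i)
  zero_mem' := fun i => HasWeakPartial.zero i
  smul_mem' := fun a _ h i => (h i).smul a

/-- The Sobolev space `H¹(ℝⁿ)` as a type. -/
abbrev H1 (n : ℕ) : Type := H1Submodule n

/-- The underlying `L²` function of an element of `H¹(ℝⁿ)`. -/
def H1.fn {n : ℕ} (u : H1 n) : L2 n := (u : WithLp 2 (L2 n × PiLp 2 (fun _ : Fin n => L2 n))).fst

/-- The weak partial derivative `∂u/∂xᵢ ∈ L²(ℝⁿ)` of `u ∈ H¹(ℝⁿ)`. -/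
def H1.grad {n : ℕ} (u : H1 n) (i : Fin n) : L2 n :=
  (u : WithLp 2 (L2 n × PiLp 2 (fun _ : Fin n => L2 n))).snd i

/-- `u` lies in `D(A) = H²(ℝⁿ)` and `A u = -Δu = w`: all weak second partial derivatives
`D i j = ∂ⱼ∂ᵢu` exist in `L²(ℝⁿ)`, and `w = -∑ᵢ ∂ᵢ∂ᵢu`. -/
def IsNegLaplacian {n : ℕ} (u : H1 n) (w : L2 n) : Prop :=
  ∃ D : Fin n → Fin n → L2 n,
    (∀ i j, HasWeakPartial j (u.grad i) (D i j)) ∧ w = - ∑ i, D i i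

/-- `u : [0, T] → H¹(ℝⁿ)` is a solution of the abstract equation `u̇ + A u = F̂(u)` in `L²(ℝⁿ)`,
where `F̂(u)(x) = F(x, u(x))`: `u` is continuous on `[0, T]` with values in `H¹`, and for
`0 < t < T` it is differentiable in `L²` with `u(t) ∈ H²` and the equation holds in `L²`. -/
def IsSolution {n : ℕ} (F : EuclideanSpace ℝ (Fin n) → ℝ → ℝ) (T : ℝ) (u : ℝ → H1 n) : Prop :=
  ContinuousOn u (Icc 0 T) ∧
  ∀ t ∈ Ioo 0 T, ∃ v w : L2 n,
    HasDerivAt (fun s => (u s).fn) v t ∧ IsNegLaplacian (u t) w ∧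
    (v + w : L2 n) =ᵐ[volume] fun x => F x ((u t).fn x)

/-- Standing assumptions on the nonlinearity: `F` is continuous, `F(x, ·)` is `C¹` for every `x`,
`F(·, 0) ∈ L²(ℝⁿ)` and `|F'_u(x, u)| ≤ C (1 + |u|^β)` with `β = 2 / (n - 2)`. -/
structure GrowthCondition {n : ℕ} (F : EuclideanSpace ℝ (Fin n) → ℝ → ℝ) (C : ℝ) : Prop where
  continuous : Continuous (fun z : EuclideanSpace ℝ (Fin n) × ℝ => F z.1 z.2)
  contDiff : ∀ x, ContDiff ℝ 1 (F x)
  memLp_zero : MemLp (fun x => F x 0) 2 volume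
  deriv_le : ∀ x u, |deriv (F x) u| ≤ C * (1 + |u| ^ (2 / ((n : ℝ) - 2)))

/-- The dissipativity condition `F(x, u) u ≤ -ν |u|² + b(x) |u|^q + c(x)`, for almost every `x`
and every `u`, with `c ∈ L¹(ℝⁿ)`, `2 ≤ q < 2n / (n - 2)`, and `b ∈ L^p(ℝⁿ)` for some (finite)
`p ≥ 2n / (2n - q (n - 2))`. -/
structure DissipativeCondition {n : ℕ} (F : EuclideanSpace ℝ (Fin n) → ℝ → ℝ) (ν q p : ℝ)
    (b c : EuclideanSpace ℝ (Fin n) → ℝ) : Prop where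
  two_le_q : 2 ≤ q
  q_lt : q < 2 * (n : ℝ) / ((n : ℝ) - 2)
  le_p : 2 * (n : ℝ) / (2 * (n : ℝ) - q * ((n : ℝ) - 2)) ≤ p
  memLp_b : MemLp b (ENNReal.ofReal p) volume
  integrable_c : Integrable c volume
  mul_le : ∀ᵐ x, ∀ u : ℝ, F x u * u ≤ -ν * |u| ^ 2 + b x * |u| ^ q + c x

end

/-! The equation is tested with `ψ * truncate M u`, where `ψ` is a Lipschitz cutoff vanishing for
`‖x‖ ≤ k/2` and equal to `1` for `‖x‖ ≥ k`. With `E = ∫ ψ * truncEnergy M u`, this gives `E' ≤ -2νE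
+ η`, and Gronwall's inequality yields the exponential plus `η / ν`.

Without truncation, Hölder's inequality would handle `b|u|^q`, but the tail would depend on `q` and
`p`, which `α` may not do. On truncated values `|u|^q` is at most `M^(2β)|u|²` for every admissible
`q`, and then membership of `b` in one fixed `L^p₀` suffices (`abs_mul_truncate_sq_le`). The price
is an error supported on `|u| ≥ M`, bounded by a multiple of `M^(-β)|u|^(2+2β)`. Since `2 + 2β =
2n/(n-2)`, the Sobolev embedding `H1.exists_eLpNorm_le` makes it small uniformly over `‖u‖ ≤ R`.

The Laplacian contributes at most `n * L * R²`, `L = 2/k` being the Lipschitz constant of `ψ`. This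
is obtained in `HasWeakPartial.inner_second_partial_le` from difference quotients, so neither a
chain rule nor a product rule for weak derivatives is needed. -/

noncomputable section

open scoped Convolution InnerProductSpace

/-! ### Translations in `L²` and weak derivatives -/

/-- Translation `(τ_a u)(x) = u(x + a)` as a linear isometry of `L²(ℝⁿ)`. -/
def translateL2 {n : ℕ} (a : EuclideanSpace ℝ (Fin n)) : L2 n →ₗᵢ[ℝ] L2 n :=
  Lp.compMeasurePreservingₗᵢ ℝ (fun x => x + a) (measurePreserving_add_right volume a)

theorem translateL2_coeFn {n : ℕ} (a : EuclideanSpace ℝ (Fin n)) (u : L2 n) :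
    translateL2 a u =ᵐ[volume] fun x => u (x + a) :=
  Lp.coeFn_compMeasurePreserving u (measurePreserving_add_right volume a)

theorem L2_inner_eq {n : ℕ} (u v : L2 n) : ⟪u, v⟫_ℝ = ∫ x, u x * v x := by
  rw [L2.inner_def]
  simp [mul_comm]

theorem L2_inner_eq_of_ae {n : ℕ} {u v : L2 n} {f g : EuclideanSpace ℝ (Fin n) → ℝ}
    (hf : u =ᵐ[volume] f) (hg : v =ᵐ[volume] g) : ⟪u, v⟫_ℝ = ∫ x, f x * g x := by
  rw [L2_inner_eq]
  apply integral_congr_ae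
  filter_upwards [hf, hg] with x h1 h2
  rw [h1, h2]

theorem L2_norm_sq_eq {n : ℕ} (u : L2 n) : ‖u‖ ^ 2 = ∫ x, u x ^ 2 := by
  rw [← real_inner_self_eq_norm_sq, L2_inner_eq]
  simp [sq]

theorem L2_integrable_mul {n : ℕ} (u v : L2 n) : Integrable (fun x => u x * v x) :=
  (Lp.memLp u).integrable_mul (p := 2) (q := 2) (Lp.memLp v)

theorem L2_integrable_sq {n : ℕ} (u : L2 n) : Integrable (fun x => u x ^ 2) := by
  simpa [sq] using L2_integrable_mul u u

theorem L2_locallyIntegrable {n : ℕ} (u : L2 n) : LocallyIntegrable u :=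
  (Lp.memLp u).locallyIntegrable (by norm_num)

theorem L2_integral_norm_mul_norm_le {n : ℕ} (u v : L2 n) :
    ∫ x, ‖u x‖ * ‖v x‖ ≤ ‖u‖ * ‖v‖ := by
  have := real_inner_le_norm |u| |v|
  rwa [L2_inner_eq_of_ae (Lp.coeFn_abs u) (Lp.coeFn_abs v), norm_abs_eq_norm,
    norm_abs_eq_norm] at this

theorem translateL2_inner {n : ℕ} (a : EuclideanSpace ℝ (Fin n)) (u v : L2 n) :
    ⟪translateL2 a u, v⟫_ℝ = ⟪u, translateL2 (-a) v⟫_ℝ := by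
  rw [L2_inner_eq_of_ae (translateL2_coeFn a u) (ae_eq_refl v),
    L2_inner_eq_of_ae (ae_eq_refl u) (translateL2_coeFn (-a) v)]
  rw [← integral_add_right_eq_self (fun x => u x * v (x + -a)) a]
  simp

theorem translateL2_zero {n : ℕ} (u : L2 n) : translateL2 0 u = u := by
  apply Lp.ext
  filter_upwards [translateL2_coeFn 0 u] with x hx
  simp [hx]

/-- Weak partial derivatives pass to the convolution with a test function. -/
theorem HasWeakPartial.convolution_hasFDerivAt {n : ℕ} {i : Fin n} {u v : L2 n}
    (h : HasWeakPartial i u v) {φ : EuclideanSpace ℝ (Fin n) → ℝ} (hφ : ContDiff ℝ ∞ φ)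
    (hs : HasCompactSupport φ) (x : EuclideanSpace ℝ (Fin n)) :
    fderiv ℝ (u ⋆[ContinuousLinearMap.lsmul ℝ ℝ] φ) x (EuclideanSpace.single i 1) =
      (v ⋆[ContinuousLinearMap.lsmul ℝ ℝ] φ) x := by
  have h1 : ContDiff ℝ 1 φ := hφ.of_le (by exact_mod_cast le_top)
  rw [(hs.hasFDerivAt_convolution_right (ContinuousLinearMap.lsmul ℝ ℝ)
    (L2_locallyIntegrable u) h1 x).fderiv,
    convolution_precompR_apply _ (L2_locallyIntegrable u) (hs.fderiv (𝕜 := ℝ))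
      (h1.continuous_fderiv one_ne_zero)]
  have hφ' : ContDiff ℝ ∞ (fun t => φ (x - t)) := hφ.comp (contDiff_const.sub contDiff_id)
  have hs' : HasCompactSupport (fun t => φ (x - t)) :=
    hs.comp_homeomorph (Homeomorph.subLeft x)
  have key := h _ hφ' hs'
  have hd (t : EuclideanSpace ℝ (Fin n)) : fderiv ℝ (fun t => φ (x - t)) t
      (EuclideanSpace.single i 1) = - fderiv ℝ φ (x - t) (EuclideanSpace.single i 1) := by
    have := ((h1.differentiable one_ne_zero (x - t)).hasFDerivAt.comp t
      ((hasFDerivAt_id t).const_sub x)).fderiv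
    change fderiv ℝ (fun t => φ (x - t)) t = _ at this
    rw [this]
    simp
  simp only [hd, mul_neg, integral_neg, neg_inj] at key
  simpa [convolution_def] using key

theorem exists_contDiff_tendsto_L2 {n : ℕ} (g : L2 n) :
    ∃ G : ℕ → L2 n, Tendsto G atTop (𝓝 g) ∧ ∀ j, ∃ φ : EuclideanSpace ℝ (Fin n) → ℝ,
      G j =ᵐ[volume] φ ∧ HasCompactSupport φ ∧ ContDiff ℝ ∞ φ := by
  have hd : Dense {f : L2 n | ∃ φ : EuclideanSpace ℝ (Fin n) → ℝ,
      f =ᵐ[volume] φ ∧ HasCompactSupport φ ∧ ContDiff ℝ ∞ φ} :=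
    Lp.dense_hasCompactSupport_contDiff (by norm_num)
  obtain ⟨G, hG, hlim⟩ := mem_closure_iff_seq_limit.1 (hd g)
  exact ⟨G, hlim, hG⟩

/-- The pairing is the convolution with the reflected test function, evaluated along the line `s •
e`; this convolution is smooth and its partial derivative is known. -/
theorem HasWeakPartial.hasDerivAt_inner_test {n : ℕ} {i : Fin n} {u v : L2 n}
    (h : HasWeakPartial i u v) {g : L2 n} {φ : EuclideanSpace ℝ (Fin n) → ℝ}
    (hg : g =ᵐ[volume] φ) (hφ : ContDiff ℝ ∞ φ) (hs : HasCompactSupport φ) (r : ℝ) :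
    HasDerivAt (fun s : ℝ => ⟪translateL2 (s • EuclideanSpace.single i (1 : ℝ)) u, g⟫_ℝ)
      ⟪translateL2 (r • EuclideanSpace.single i (1 : ℝ)) v, g⟫_ℝ r := by
  set e : EuclideanSpace ℝ (Fin n) := EuclideanSpace.single i 1
  have hψ : ContDiff ℝ ∞ (fun t => φ (-t)) := hφ.comp contDiff_neg
  have hψs : HasCompactSupport (fun t => φ (-t)) := hs.comp_homeomorph (Homeomorph.neg _)
  have hconv (w : L2 n) (s : ℝ) : ⟪translateL2 (s • e) w, g⟫_ℝ =
      (w ⋆[ContinuousLinearMap.lsmul ℝ ℝ] fun t => φ (-t)) (s • e) := by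
    rw [L2_inner_eq_of_ae (translateL2_coeFn _ w) hg, convolution_def,
      ← integral_add_right_eq_self (fun t => ContinuousLinearMap.lsmul ℝ ℝ (w t) _) (s • e)]
    simp
  simp only [hconv]
  rw [← h.convolution_hasFDerivAt hψ hψs]
  have hdiff : ContDiff ℝ ∞ (u ⋆[ContinuousLinearMap.lsmul ℝ ℝ] fun t => φ (-t)) :=
    hψs.contDiff_convolution_right _ (L2_locallyIntegrable u) hψ
  have h1 := (hdiff.differentiable (by simp) (r • e)).hasFDerivAt
  have h2 : HasDerivAt (fun s : ℝ => s • e) e r := by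
    simpa using (hasDerivAt_id r).smul_const e
  exact h1.comp_hasDerivAt r h2

/-- Weak derivatives are derivatives of translations, tested against `L²` functions. -/
theorem HasWeakPartial.hasDerivAt_inner {n : ℕ} {i : Fin n} {u v : L2 n}
    (h : HasWeakPartial i u v) (g : L2 n) (r : ℝ) :
    HasDerivAt (fun s : ℝ => ⟪translateL2 (s • EuclideanSpace.single i (1 : ℝ)) u, g⟫_ℝ)
      ⟪translateL2 (r • EuclideanSpace.single i (1 : ℝ)) v, g⟫_ℝ r := by
  obtain ⟨G, hG, hGφ⟩ := exists_contDiff_tendsto_L2 g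
  -- Translations are isometries, so the derivatives for the approximants `G j` converge uniformly
  -- in `s`.
  refine hasDerivAt_of_tendstoUniformly
    (f := fun j s => ⟪translateL2 (s • EuclideanSpace.single i (1 : ℝ)) u, G j⟫_ℝ)
    (f' := fun j s => ⟪translateL2 (s • EuclideanSpace.single i (1 : ℝ)) v, G j⟫_ℝ)
    (g' := fun s => ⟪translateL2 (s • EuclideanSpace.single i (1 : ℝ)) v, g⟫_ℝ)
    (l := atTop) ?_ ?_ ?_ r
  · rw [Metric.tendstoUniformly_iff]
    intro ε hε
    have hlim : Tendsto (fun j => ‖v‖ * ‖g - G j‖) atTop (𝓝 0) := by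
      have : Tendsto (fun j => ‖v‖ * ‖g - G j‖) atTop (𝓝 (‖v‖ * ‖g - g‖)) :=
        ((tendsto_const_nhds.sub hG).norm).const_mul _
      simpa using this
    filter_upwards [hlim.eventually_lt_const hε] with j hj s
    rw [Real.dist_eq, ← inner_sub_right]
    refine lt_of_le_of_lt (abs_real_inner_le_norm _ _) ?_
    rwa [LinearIsometry.norm_map]
  · refine Eventually.of_forall fun j s => ?_
    obtain ⟨φ, h1, h2, h3⟩ := hGφ j
    exact h.hasDerivAt_inner_test h1 h3 h2 s
  · exact fun s => tendsto_const_nhds.inner hG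

/-- Pairing with the difference `g` itself, the mean value inequality gives `‖g‖² ≤ ‖v‖ * ‖g‖ *
|s|`. -/
theorem HasWeakPartial.norm_translate_sub_le {n : ℕ} {i : Fin n} {u v : L2 n}
    (h : HasWeakPartial i u v) (s : ℝ) :
    ‖translateL2 (s • EuclideanSpace.single i (1 : ℝ)) u - u‖ ≤ ‖v‖ * |s| := by
  set g := translateL2 (s • EuclideanSpace.single i (1 : ℝ)) u - u with hg
  have key := Convex.norm_image_sub_le_of_norm_hasDerivWithin_le (s := univ) (C := ‖v‖ * ‖g‖)
    (fun r _ => (h.hasDerivAt_inner g r).hasDerivWithinAt) (fun r _ => by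
      refine (abs_real_inner_le_norm _ _).trans ?_
      rw [LinearIsometry.norm_map]) convex_univ (mem_univ 0) (mem_univ s)
  rw [zero_smul, translateL2_zero, ← inner_sub_left, ← hg, real_inner_self_eq_norm_sq] at key
  simp only [Real.norm_eq_abs, abs_pow, abs_norm, sub_zero] at key
  rcases (norm_nonneg g).eq_or_lt with h0 | h0
  · rw [← h0]; positivity
  · nlinarith

/-! ### The Laplacian tested against a monotone function of `u` -/

/-- If `d > K`, then `f ≤ 0 = f 0` has positive second derivative at `0`, hence a local minimum
there; so `f` vanishes near `0`, contradicting `f'' 0 > 0`. -/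
theorem second_deriv_le_of_second_difference_le {m m₁ : ℝ → ℝ} {d K : ℝ}
    (hm : ∀ r, HasDerivAt m (m₁ r) r) (hm₁ : HasDerivAt m₁ d 0)
    (hK : ∀ h, m h + m (-h) - 2 * m 0 ≤ K * h ^ 2) : d ≤ K := by
  by_contra! hlt
  set f : ℝ → ℝ := fun h => m h + m (-h) - 2 * m 0 - K * h ^ 2 with hf
  have hf' (r : ℝ) : HasDerivAt f (m₁ r - m₁ (-r) - 2 * K * r) r := by
    have := (((hm r).add ((hm (-r)).scomp r (hasDerivAt_neg r))).sub_const (2 * m 0)).sub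
      ((hasDerivAt_pow 2 r).const_mul K)
    convert! this using 1
    simp
    ring
  have hderiv : deriv f = fun r => m₁ r - m₁ (-r) - 2 * K * r := funext fun r => (hf' r).deriv
  have hf'' : HasDerivAt (deriv f) (2 * d - 2 * K) 0 := by
    rw [hderiv]
    have h0 : HasDerivAt m₁ d (-0) := by simpa using hm₁
    have := (hm₁.sub (h0.scomp (0 : ℝ) (hasDerivAt_neg 0))).sub
      ((hasDerivAt_id (0 : ℝ)).const_mul (2 * K))
    convert! this using 1
    simp
    ring
  have hmin := isLocalMin_of_deriv_deriv_pos (f := f) (x₀ := 0)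
    (by rw [hf''.deriv]; linarith) (by simp [hderiv]) (hf' 0).continuousAt
  have hzero : f =ᶠ[𝓝 0] fun _ => (0 : ℝ) := by
    filter_upwards [hmin] with x hx
    have h0 : f 0 = 0 := by simp [hf]; ring
    have h1 : f x ≤ 0 := by simp only [hf]; linarith [hK x]
    linarith
  have h1 : deriv (deriv f) 0 = 0 := by
    rw [hzero.deriv.deriv_eq]
    simp
  rw [hf''.deriv] at h1
  linarith

/-- Testing `∂ᵢ∂ᵢu` against `ψ φ(u)` with `φ` monotone, `ψ ≥ 0` Lipschitz. -/
theorem HasWeakPartial.inner_second_partial_le {n : ℕ} {i : Fin n} {u v D g : L2 n}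
    (hv : HasWeakPartial i u v) (hD : HasWeakPartial i v D)
    {ψ : EuclideanSpace ℝ (Fin n) → ℝ} {φ : ℝ → ℝ} {L : ℝ}
    (hg : g =ᵐ[volume] fun x => ψ x * φ (u x)) (hψ : ∀ x, 0 ≤ ψ x)
    (hL : ∀ x y, |ψ x - ψ y| ≤ L * ‖x - y‖) (hφ : Monotone φ) (hφ' : ∀ s, |φ s| ≤ |s|) :
    ⟪D, g⟫_ℝ ≤ L * ‖u‖ * ‖v‖ := by
  set e : EuclideanSpace ℝ (Fin n) := EuclideanSpace.single i 1 with he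
  have hL0 : 0 ≤ L := by
    have := (abs_nonneg _).trans (hL e 0)
    simpa [he] using this
  refine second_deriv_le_of_second_difference_le (fun r => hv.hasDerivAt_inner g r)
    (by simpa [translateL2_zero] using hD.hasDerivAt_inner g 0) fun h => ?_
  rw [← he, zero_smul, translateL2_zero, neg_smul, translateL2_inner (-(h • e)), neg_neg]
  set a := h • e with ha
  -- Discrete integration by parts: the second difference becomes a product of first differences.
  have e1 : ⟪translateL2 a u, g⟫_ℝ + ⟪u, translateL2 a g⟫_ℝ - 2 * ⟪u, g⟫_ℝ =
      - ⟪translateL2 a u - u, translateL2 a g - g⟫_ℝ := by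
    have : ⟪translateL2 a u, translateL2 a g⟫_ℝ = ⟪u, g⟫_ℝ := LinearIsometry.inner_map_map _ _ _
    simp only [inner_sub_left, inner_sub_right]
    linarith
  have hw : (translateL2 a u - u : L2 n) =ᵐ[volume] fun x => u (x + a) - u x := by
    filter_upwards [Lp.coeFn_sub (translateL2 a u) u, translateL2_coeFn a u] with x h1 h2
    rw [h1, Pi.sub_apply, h2]
  have hga : (translateL2 a g - g : L2 n) =ᵐ[volume]
      fun x => ψ (x + a) * φ (u (x + a)) - ψ x * φ (u x) := by
    have hg' := (measurePreserving_add_right volume a).quasiMeasurePreserving.ae hg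
    filter_upwards [Lp.coeFn_sub (translateL2 a g) g, translateL2_coeFn a g, hg, hg']
      with x h1 h2 h3 h4
    rw [h1, Pi.sub_apply, h2, h3, h4]
  have hna : ‖a‖ = |h| := by simp [ha, he, norm_smul]
  -- The increment of `ψ φ(u)` splits into `ψ(x+a)` times the increment of `φ(u)`, whose
  -- contribution has a favourable sign by monotonicity, and the increment of `ψ` times `φ(u)`,
  -- which is at most `L|h||u|`.
  have hpt : ∀ᵐ x, -((translateL2 a u - u : L2 n) x * (translateL2 a g - g : L2 n) x) ≤
      L * |h| * (‖(translateL2 a u - u : L2 n) x‖ * ‖u x‖) := by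
    filter_upwards [hw, hga] with x h1 h2
    rw [h1, h2, Real.norm_eq_abs, Real.norm_eq_abs]
    have hmono : 0 ≤ (u (x + a) - u x) * (φ (u (x + a)) - φ (u x)) := by
      rcases le_total (u x) (u (x + a)) with hle | hle
      · exact mul_nonneg (sub_nonneg.2 hle) (sub_nonneg.2 (hφ hle))
      · exact mul_nonneg_of_nonpos_of_nonpos (sub_nonpos.2 hle) (sub_nonpos.2 (hφ hle))
    have hbd : |(u (x + a) - u x) * ((ψ (x + a) - ψ x) * φ (u x))| ≤
        |u (x + a) - u x| * (L * |h| * |u x|) := by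
      rw [abs_mul, abs_mul]
      have := hL (x + a) x
      rw [add_sub_cancel_left, hna] at this
      exact mul_le_mul_of_nonneg_left (mul_le_mul this (hφ' _) (abs_nonneg _) (by positivity))
        (abs_nonneg _)
    have := mul_nonneg (hψ (x + a)) hmono
    nlinarith [neg_abs_le ((u (x + a) - u x) * ((ψ (x + a) - ψ x) * φ (u x)))]
  have hint : ∫ x, ‖(translateL2 a u - u : L2 n) x‖ * ‖u x‖ ≤ ‖translateL2 a u - u‖ * ‖u‖ :=
    L2_integral_norm_mul_norm_le _ _
  have hi1 : Integrable fun x => ‖(translateL2 a u - u : L2 n) x‖ * ‖u x‖ := by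
    simpa [norm_mul] using (L2_integrable_mul (translateL2 a u - u) u).norm
  rw [e1, L2_inner_eq, ← integral_neg]
  calc _ ≤ ∫ x, L * |h| * (‖(translateL2 a u - u : L2 n) x‖ * ‖u x‖) :=
        integral_mono_ae (L2_integrable_mul _ _).neg (hi1.const_mul _) hpt
    _ ≤ L * |h| * (‖translateL2 a u - u‖ * ‖u‖) := by
        rw [integral_const_mul]
        gcongr
    _ ≤ L * |h| * (‖v‖ * |h| * ‖u‖) := by
        gcongr
        exact hv.norm_translate_sub_le h
    _ = L * ‖u‖ * ‖v‖ * h ^ 2 := by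
        rw [← sq_abs h]
        ring

/-! ### Mollification and the Sobolev embedding -/

/-- Cauchy–Schwarz after writing `|ρ| = |ρ|^(1/2) * |ρ|^(1/2)`, the second factor having unit `L²`
norm. -/
theorem enorm_convolution_sq_le {n : ℕ} {u : EuclideanSpace ℝ (Fin n) → ℝ}
    (hu : AEStronglyMeasurable u) {ρ : EuclideanSpace ℝ (Fin n) → ℝ} (hρ : Continuous ρ)
    (h1 : ∫⁻ t, ‖ρ t‖ₑ = 1) (x : EuclideanSpace ℝ (Fin n)) :
    ‖(u ⋆[ContinuousLinearMap.lsmul ℝ ℝ] ρ) x‖ₑ ^ (2 : ℝ) ≤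
      ∫⁻ t, ‖u t‖ₑ ^ (2 : ℝ) * ‖ρ (x - t)‖ₑ := by
  have hx : ∫⁻ t, ‖ρ (x - t)‖ₑ = 1 := by
    rw [lintegral_sub_left_eq_self (fun t => ‖ρ t‖ₑ) x, h1]
  have hm : AEMeasurable (fun t => ‖ρ (x - t)‖ₑ ^ (1 / 2 : ℝ)) :=
    ((hρ.comp (continuous_const.sub continuous_id)).measurable.enorm.pow_const _).aemeasurable
  have hsplit (t : EuclideanSpace ℝ (Fin n)) : ‖ρ (x - t)‖ₑ ^ (1 / 2 : ℝ) *
      ‖ρ (x - t)‖ₑ ^ (1 / 2 : ℝ) = ‖ρ (x - t)‖ₑ := by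
    rw [← ENNReal.rpow_add_of_nonneg _ _ (by norm_num) (by norm_num)]
    norm_num
  have hsq (t : EuclideanSpace ℝ (Fin n)) : (‖ρ (x - t)‖ₑ ^ (1 / 2 : ℝ)) ^ (2 : ℝ) =
      ‖ρ (x - t)‖ₑ := by
    rw [← ENNReal.rpow_mul]
    norm_num
  have holder := ENNReal.lintegral_mul_le_Lp_mul_Lq volume Real.HolderConjugate.two_two
    (hu.enorm.mul hm) hm
  have hle : ‖(u ⋆[ContinuousLinearMap.lsmul ℝ ℝ] ρ) x‖ₑ ≤
      (∫⁻ t, ‖u t‖ₑ ^ (2 : ℝ) * ‖ρ (x - t)‖ₑ) ^ (1 / 2 : ℝ) := by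
    refine (enorm_integral_le_lintegral_enorm _).trans ?_
    simp only [Pi.mul_apply, mul_assoc, hsplit,
      ENNReal.mul_rpow_of_nonneg _ _ (zero_le_two (α := ℝ)), hsq, hx, ENNReal.one_rpow,
      mul_one] at holder
    simpa [enorm_mul] using holder
  calc _ ≤ ((∫⁻ t, ‖u t‖ₑ ^ (2 : ℝ) * ‖ρ (x - t)‖ₑ) ^ (1 / 2 : ℝ)) ^ (2 : ℝ) := by gcongr
    _ = _ := by
      rw [← ENNReal.rpow_mul]
      norm_num

/-- Convolution with a normalized kernel does not increase the `L²` norm. -/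
theorem eLpNorm_convolution_le {n : ℕ} {u : EuclideanSpace ℝ (Fin n) → ℝ}
    (hu : AEStronglyMeasurable u) {ρ : EuclideanSpace ℝ (Fin n) → ℝ} (hρ : Continuous ρ)
    (h1 : ∫⁻ t, ‖ρ t‖ₑ = 1) :
    eLpNorm (u ⋆[ContinuousLinearMap.lsmul ℝ ℝ] ρ) 2 volume ≤ eLpNorm u 2 volume := by
  simp only [eLpNorm_eq_lintegral_rpow_enorm_toReal two_ne_zero ENNReal.ofNat_ne_top,
    ENNReal.toReal_ofNat]
  refine ENNReal.rpow_le_rpow ?_ (by norm_num)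
  calc _ ≤ ∫⁻ x, ∫⁻ t, ‖u t‖ₑ ^ (2 : ℝ) * ‖ρ (x - t)‖ₑ :=
        lintegral_mono fun x => enorm_convolution_sq_le hu hρ h1 x
    _ = ∫⁻ t, ∫⁻ x, ‖u t‖ₑ ^ (2 : ℝ) * ‖ρ (x - t)‖ₑ := by
        refine lintegral_lintegral_swap ?_
        refine AEMeasurable.mul ?_ ?_
        · exact (hu.enorm.pow_const _).comp_snd
        · exact (hρ.comp (continuous_fst.sub continuous_snd)).measurable.enorm.aemeasurable
    _ = ∫⁻ t, ‖u t‖ₑ ^ (2 : ℝ) := by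
        refine lintegral_congr fun t => ?_
        rw [lintegral_const_mul' _ _ (by simp), lintegral_sub_right_eq_self (fun x => ‖ρ x‖ₑ) t,
          h1, mul_one]

theorem norm_le_sum_abs_apply_single {n : ℕ} (f : EuclideanSpace ℝ (Fin n) →L[ℝ] ℝ) :
    ‖f‖ ≤ ∑ i, |f (EuclideanSpace.single i 1)| := by
  refine f.opNorm_le_bound (by positivity) fun x => ?_
  have hx : x = ∑ i, x i • EuclideanSpace.single i (1 : ℝ) := by
    simpa using ((EuclideanSpace.basisFun (Fin n) ℝ).sum_repr x).symm
  calc ‖f x‖ = ‖∑ i, x i * f (EuclideanSpace.single i 1)‖ := by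
        conv_lhs => rw [hx]
        simp
    _ ≤ ∑ i, ‖x i * f (EuclideanSpace.single i 1)‖ := norm_sum_le _ _
    _ ≤ ∑ i, ‖x‖ * |f (EuclideanSpace.single i 1)| := by
        gcongr with i
        rw [norm_mul]
        exact mul_le_mul_of_nonneg_right (PiLp.norm_apply_le x i) (abs_nonneg _)
    _ = _ := by rw [← Finset.mul_sum, mul_comm]

theorem H1.norm_sq_eq {n : ℕ} (u : H1 n) : ‖u‖ ^ 2 = ‖u.fn‖ ^ 2 + ∑ i, ‖u.grad i‖ ^ 2 := by
  rw [← Submodule.norm_coe u, WithLp.prod_norm_sq_eq_of_L2, PiLp.norm_sq_eq_of_L2]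
  rfl

theorem H1.norm_fn_le {n : ℕ} (u : H1 n) : ‖u.fn‖ ≤ ‖u‖ := by
  refine abs_le_of_sq_le_sq' ?_ (norm_nonneg _) |>.2
  rw [H1.norm_sq_eq]
  have : 0 ≤ ∑ i, ‖u.grad i‖ ^ 2 := by positivity
  linarith

theorem H1.norm_grad_le {n : ℕ} (u : H1 n) (i : Fin n) : ‖u.grad i‖ ≤ ‖u‖ := by
  refine abs_le_of_sq_le_sq' ?_ (norm_nonneg _) |>.2
  rw [H1.norm_sq_eq]
  have := Finset.single_le_sum (f := fun i => ‖u.grad i‖ ^ 2) (fun i _ => by positivity)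
    (Finset.mem_univ i)
  have := sq_nonneg ‖u.fn‖
  linarith

theorem H1.hasWeakPartial {n : ℕ} (u : H1 n) (i : Fin n) : HasWeakPartial i u.fn (u.grad i) :=
  u.2 i

theorem L2_eLpNorm_le {n : ℕ} {u : L2 n} {r : ℝ} (h : ‖u‖ ≤ r) :
    eLpNorm u 2 volume ≤ ENNReal.ofReal r := by
  rw [← Lp.enorm_def, ← ofReal_norm]
  exact ENNReal.ofReal_le_ofReal h

/-- The gradient of a mollified and cut-off `H¹` function is controlled by the `H¹` norm. -/
theorem H1.eLpNorm_fderiv_cutoff_le {n : ℕ} (u : H1 n) {ρ : EuclideanSpace ℝ (Fin n) → ℝ}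
    (hρ : ContDiff ℝ ∞ ρ) (hρs : HasCompactSupport ρ) (h1 : ∫⁻ t, ‖ρ t‖ₑ = 1)
    {χ : EuclideanSpace ℝ (Fin n) → ℝ} (hχ : ContDiff ℝ ∞ χ) (hχ1 : ∀ x, |χ x| ≤ 1) {A : ℝ}
    (hχ' : ∀ x, ‖fderiv ℝ χ x‖ ≤ A) :
    eLpNorm (fderiv ℝ fun x => χ x * (u.fn ⋆[ContinuousLinearMap.lsmul ℝ ℝ] ρ) x) 2 volume ≤
      ENNReal.ofReal ((n + A) * ‖u‖) := by
  have hA : 0 ≤ A := (norm_nonneg _).trans (hχ' 0)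
  have hcd : ContDiff ℝ ∞ (u.fn ⋆[ContinuousLinearMap.lsmul ℝ ℝ] ρ) :=
    hρs.contDiff_convolution_right _ (L2_locallyIntegrable _) hρ
  have hcg (i : Fin n) : Continuous (u.grad i ⋆[ContinuousLinearMap.lsmul ℝ ℝ] ρ) :=
    (hρs.contDiff_convolution_right (n := ⊤) _ (L2_locallyIntegrable _) hρ).continuous
  have hpt (x : EuclideanSpace ℝ (Fin n)) :
      ‖fderiv ℝ (fun x => χ x * (u.fn ⋆[ContinuousLinearMap.lsmul ℝ ℝ] ρ) x) x‖ ≤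
        (∑ i, |(u.grad i ⋆[ContinuousLinearMap.lsmul ℝ ℝ] ρ) x|) +
          A * |(u.fn ⋆[ContinuousLinearMap.lsmul ℝ ℝ] ρ) x| := by
    rw [fderiv_fun_mul (hχ.differentiable (by simp) x) (hcd.differentiable (by simp) x)]
    refine (norm_add_le _ _).trans (add_le_add ?_ ?_)
    · rw [norm_smul]
      refine (mul_le_of_le_one_left (norm_nonneg _) (hχ1 x)).trans ?_
      refine (norm_le_sum_abs_apply_single _).trans_eq ?_
      simp only [(u.hasWeakPartial _).convolution_hasFDerivAt hρ hρs]
    · rw [norm_smul, mul_comm]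
      exact mul_le_mul_of_nonneg_right (hχ' x) (norm_nonneg _)
  calc _ ≤ eLpNorm ((∑ i, fun x => |(u.grad i ⋆[ContinuousLinearMap.lsmul ℝ ℝ] ρ) x|) +
          A • fun x => |(u.fn ⋆[ContinuousLinearMap.lsmul ℝ ℝ] ρ) x|) 2 volume := by
        refine eLpNorm_mono_real fun x => ?_
        simpa using hpt x
    _ ≤ (∑ i, eLpNorm (fun x => |(u.grad i ⋆[ContinuousLinearMap.lsmul ℝ ℝ] ρ) x|) 2 volume) +
          eLpNorm (A • fun x => |(u.fn ⋆[ContinuousLinearMap.lsmul ℝ ℝ] ρ) x|) 2 volume := by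
        refine (eLpNorm_add_le ?_ ?_ (by norm_num)).trans
          (add_le_add_left (eLpNorm_sum_le ?_ (by norm_num)) _)
        · exact Finset.aestronglyMeasurable_sum _ fun i _ => (hcg i).abs.aestronglyMeasurable
        · exact (hcd.continuous.abs.const_smul A).aestronglyMeasurable
        · exact fun i _ => (hcg i).abs.aestronglyMeasurable
    _ ≤ (∑ _i : Fin n, ENNReal.ofReal ‖u‖) + ENNReal.ofReal A * ENNReal.ofReal ‖u‖ := by
        rw [eLpNorm_const_smul]
        refine add_le_add (Finset.sum_le_sum fun i _ => ?_) (mul_le_mul' ?_ ?_)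
        · rw [show (fun x => |(u.grad i ⋆[ContinuousLinearMap.lsmul ℝ ℝ] ρ) x|) = fun x =>
            ‖(u.grad i ⋆[ContinuousLinearMap.lsmul ℝ ℝ] ρ) x‖ from rfl, eLpNorm_norm]
          exact (eLpNorm_convolution_le (Lp.aestronglyMeasurable _) hρ.continuous h1).trans
            (L2_eLpNorm_le (u.norm_grad_le i))
        · rw [← ofReal_norm, Real.norm_of_nonneg hA]
        · rw [show (fun x => |(u.fn ⋆[ContinuousLinearMap.lsmul ℝ ℝ] ρ) x|) = fun x =>
            ‖(u.fn ⋆[ContinuousLinearMap.lsmul ℝ ℝ] ρ) x‖ from rfl, eLpNorm_norm]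
          exact (eLpNorm_convolution_le (Lp.aestronglyMeasurable _) hρ.continuous h1).trans
            (L2_eLpNorm_le u.norm_fn_le)
    _ = ENNReal.ofReal ((n + A) * ‖u‖) := by
        rw [add_mul, ENNReal.ofReal_add (by positivity) (by positivity), ENNReal.ofReal_mul hA,
          ENNReal.ofReal_mul (by positivity)]
        simp

/-- The Sobolev embedding `H¹(ℝⁿ) ⊂ L^{2n/(n-2)}(ℝⁿ)`. -/
theorem H1.exists_eLpNorm_le (n : ℕ) (hn : 3 ≤ n) : ∃ K : ℝ, 0 ≤ K ∧ ∀ u : H1 n,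
    eLpNorm u.fn (ENNReal.ofReal (2 * n / (n - 2))) volume ≤ ENNReal.ofReal (K * ‖u‖) := by
  have hn' : (3 : ℝ) ≤ n := by exact_mod_cast hn
  let χ₀ : ContDiffBump (0 : EuclideanSpace ℝ (Fin n)) := ⟨1, 2, one_pos, one_lt_two⟩
  obtain ⟨A, hA⟩ : ∃ A, ∀ x, ‖fderiv ℝ χ₀ x‖ ≤ A :=
    ((χ₀.contDiff (n := 1)).continuous_fderiv one_ne_zero).bounded_above_of_compact_support
      (χ₀.hasCompactSupport.fderiv (𝕜 := ℝ))
  have hA0 : 0 ≤ A := (norm_nonneg _).trans (hA 0)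
  let G := SNormLESNormFDerivOfEqConst ℝ (volume : Measure (EuclideanSpace ℝ (Fin n))) 2
  refine ⟨G * (n + A), by positivity, fun u => ?_⟩
  have hpos (j : ℕ) : (0 : ℝ) < 1 / ((j : ℝ) + 1) := Nat.one_div_pos_of_nat
  let ρ (j : ℕ) : ContDiffBump (0 : EuclideanSpace ℝ (Fin n)) :=
    ⟨1 / ((j : ℝ) + 1), 2 * (1 / ((j : ℝ) + 1)), hpos j, by linarith [hpos j]⟩
  -- The Gagliardo–Nirenberg–Sobolev inequality needs compactly supported `C¹` functions, hence
  -- cutoff and mollification. Dilating by a factor at most `1` keeps the gradient of `χ j` below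
  -- `A` for all `j`.
  let χ (j : ℕ) (x : EuclideanSpace ℝ (Fin n)) : ℝ := χ₀ ((1 / ((j : ℝ) + 1)) • x)
  let w (j : ℕ) (x : EuclideanSpace ℝ (Fin n)) : ℝ :=
    χ j x * (u.fn ⋆[ContinuousLinearMap.lsmul ℝ ℝ] (ρ j).normed volume) x
  have hχ (j : ℕ) : ContDiff ℝ ∞ (χ j) := χ₀.contDiff.comp (contDiff_const_smul _)
  have hχs (j : ℕ) : HasCompactSupport (χ j) :=
    χ₀.hasCompactSupport.comp_homeomorph (Homeomorph.smulOfNeZero _ (hpos j).ne')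
  have hχ' (j : ℕ) (x : EuclideanSpace ℝ (Fin n)) : ‖fderiv ℝ (χ j) x‖ ≤ A := by
    have h2 : χ j = fun x => χ₀ ((1 / ((j : ℝ) + 1)) • x) := rfl
    rw [h2, fderiv_comp_smul, norm_smul, Real.norm_of_nonneg (hpos j).le]
    have h3 : 1 / ((j : ℝ) + 1) ≤ 1 := by
      rw [div_le_one (by positivity)]
      linarith [(Nat.cast_nonneg j : (0 : ℝ) ≤ j)]
    exact (mul_le_of_le_one_left (norm_nonneg _) h3).trans (hA _)
  have hχ1 (j : ℕ) (x : EuclideanSpace ℝ (Fin n)) : |χ j x| ≤ 1 := by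
    rw [abs_of_nonneg χ₀.nonneg]
    exact χ₀.le_one
  have hρ1 (j : ℕ) : ∫⁻ t, ‖(ρ j).normed volume t‖ₑ = 1 := by
    simp only [← ofReal_norm, Real.norm_of_nonneg ((ρ j).nonneg_normed _)]
    rw [← ofReal_integral_eq_lintegral_ofReal (ρ j).integrable_normed
      (Eventually.of_forall (ρ j).nonneg_normed), (ρ j).integral_normed, ENNReal.ofReal_one]
  have hwc (j : ℕ) : ContDiff ℝ ∞ (w j) := (hχ j).mul
    ((ρ j).hasCompactSupport_normed.contDiff_convolution_right _ (L2_locallyIntegrable _)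
      (ρ j).contDiff_normed)
  have hws (j : ℕ) : HasCompactSupport (w j) := (hχs j).mul_right
  have hlim : ∀ᵐ x, Tendsto (fun j => w j x) atTop (𝓝 (u.fn x)) := by
    have hout : Tendsto (fun j => (ρ j).rOut) atTop (𝓝 0) := by
      have := (tendsto_one_div_add_atTop_nhds_zero_nat (𝕜 := ℝ)).const_mul 2
      rwa [mul_zero] at this
    filter_upwards [ContDiffBump.ae_convolution_tendsto_right_of_locallyIntegrable hout
      (K := 2) (Eventually.of_forall fun j => le_rfl) (L2_locallyIntegrable u.fn)] with x hx
    have hχx : Tendsto (fun j => χ j x) atTop (𝓝 1) := by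
      have h0 : Tendsto (fun j : ℕ => (1 / ((j : ℝ) + 1)) • x) atTop (𝓝 ((0 : ℝ) • x)) :=
        tendsto_one_div_add_atTop_nhds_zero_nat.smul_const x
      have h1 := (χ₀.continuous.tendsto _).comp h0
      rwa [zero_smul, χ₀.one_of_mem_closedBall (Metric.mem_closedBall_self χ₀.rIn_pos.le)] at h1
    have := hχx.mul hx
    rw [one_mul] at this
    refine this.congr fun j => ?_
    simp only [w]
    congr 1
    rw [convolution_eq_swap, convolution_def]
    simp [mul_comm]
  have hwle (j : ℕ) : eLpNorm (w j) (ENNReal.ofReal (2 * n / (n - 2))) volume ≤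
      ENNReal.ofReal (G * (n + A) * ‖u‖) := by
    have hfin : Module.finrank ℝ (EuclideanSpace ℝ (Fin n)) = n := by simp
    have := eLpNorm_le_eLpNorm_fderiv_of_eq (μ := volume) ((hwc j).of_le (by exact_mod_cast le_top))
      (hws j) (p := 2) (p' := Real.toNNReal (2 * n / (n - 2))) one_le_two (by omega) (by
        rw [hfin, Real.coe_toNNReal _ (div_nonneg (by positivity) (by linarith))]
        have : (n : ℝ) - 2 ≠ 0 := by linarith
        push_cast
        field_simp)
    refine this.trans ?_
    rw [mul_assoc, ENNReal.ofReal_mul (by positivity), ENNReal.ofReal_coe_nnreal]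
    refine mul_le_mul' le_rfl ?_
    exact u.eLpNorm_fderiv_cutoff_le (ρ j).contDiff_normed (ρ j).hasCompactSupport_normed (hρ1 j)
      (hχ j) (hχ1 j) (hχ' j)
  -- Fatou's lemma: almost everywhere convergence carries the uniform bound to `u`.
  refine (Lp.eLpNorm_lim_le_liminf_eLpNorm
    (fun j => (hwc j).continuous.aestronglyMeasurable) _ hlim).trans ?_
  exact (liminf_le_liminf (Eventually.of_forall hwle)).trans_eq (liminf_const _)

/-! ### Truncation and pointwise inequalities -/

/-- Truncation of a real number to `[-M, M]`. -/
def truncate (M s : ℝ) : ℝ := max (-M) (min s M)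

/-- The primitive of `truncate M` vanishing at `0`. -/
def truncEnergy (M s : ℝ) : ℝ := s ^ 2 / 2 - max (|s| - M) 0 ^ 2 / 2

theorem truncate_mono (M : ℝ) : Monotone (truncate M) := fun _ _ h =>
  max_le_max le_rfl (min_le_min h le_rfl)

theorem continuous_truncate (M : ℝ) : Continuous (truncate M) :=
  continuous_const.max (continuous_id.min continuous_const)

theorem continuous_truncEnergy (M : ℝ) : Continuous (truncEnergy M) := by
  unfold truncEnergy
  fun_prop

theorem truncate_cases {M : ℝ} (hM : 0 ≤ M) (s : ℝ) :
    (s ≤ -M ∧ truncate M s = -M ∧ truncEnergy M s = -M * s - M ^ 2 / 2) ∨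
    (|s| ≤ M ∧ truncate M s = s ∧ truncEnergy M s = s ^ 2 / 2) ∨
    (M ≤ s ∧ truncate M s = M ∧ truncEnergy M s = M * s - M ^ 2 / 2) := by
  unfold truncate truncEnergy
  rcases le_total s (-M) with h | h
  · left
    rw [abs_of_nonpos (by linarith), min_eq_left (by linarith), max_eq_left h,
      max_eq_left (by linarith)]
    exact ⟨h, rfl, by ring⟩
  rcases le_total s M with h' | h'
  · right; left
    have : |s| ≤ M := abs_le.2 ⟨h, h'⟩
    rw [min_eq_left h', max_eq_right h, max_eq_right (by linarith)]
    exact ⟨this, rfl, by ring⟩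
  · right; right
    rw [abs_of_nonneg (by linarith), min_eq_right h', max_eq_right (by linarith),
      max_eq_left (by linarith)]
    exact ⟨h', rfl, by ring⟩

theorem abs_truncate_le {M : ℝ} (hM : 0 ≤ M) (s : ℝ) : |truncate M s| ≤ |s| := by
  rcases truncate_cases hM s with ⟨h, h1, -⟩ | ⟨-, h1, -⟩ | ⟨h, h1, -⟩ <;> rw [h1]
  · rw [abs_neg, abs_of_nonneg hM, abs_of_nonpos (by linarith)]
    linarith
  · rw [abs_of_nonneg hM, abs_of_nonneg (by linarith)]
    exact h

theorem abs_truncate_le_level {M : ℝ} (hM : 0 ≤ M) (s : ℝ) : |truncate M s| ≤ M := by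
  rcases truncate_cases hM s with ⟨h, h1, -⟩ | ⟨h, h1, -⟩ | ⟨h, h1, -⟩ <;> rw [h1]
  · rw [abs_neg, abs_of_nonneg hM]
  · exact h
  · rw [abs_of_nonneg hM]

theorem truncate_eq_self_or_le {M : ℝ} (hM : 0 ≤ M) (s : ℝ) :
    (truncate M s = s ∧ truncEnergy M s = s ^ 2 / 2) ∨ M ≤ |s| := by
  rcases truncate_cases hM s with ⟨h, -⟩ | ⟨-, h⟩ | ⟨h, -⟩
  · exact .inr (by rw [abs_of_nonpos] <;> linarith)
  · exact .inl h
  · exact .inr (h.trans (le_abs_self s))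

theorem truncEnergy_nonneg {M : ℝ} (hM : 0 ≤ M) (s : ℝ) : 0 ≤ truncEnergy M s := by
  rcases truncate_cases hM s with ⟨h, -, h1⟩ | ⟨-, -, h1⟩ | ⟨h, -, h1⟩ <;> rw [h1]
  · nlinarith
  · positivity
  · nlinarith

theorem truncEnergy_le (M s : ℝ) : truncEnergy M s ≤ s ^ 2 / 2 := by
  unfold truncEnergy
  have := sq_nonneg (max (|s| - M) 0)
  linarith

/-- Taylor remainder of a primitive whose derivative `truncate M` is 1-Lipschitz. Being quadratic
and uniform in `a`, it integrates to a Fréchet remainder on `L²`. -/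
theorem abs_truncEnergy_sub_le {M : ℝ} (hM : 0 ≤ M) (a b : ℝ) :
    |truncEnergy M b - truncEnergy M a - truncate M a * (b - a)| ≤ (b - a) ^ 2 := by
  rw [abs_le]
  rcases truncate_cases hM a with ⟨h, h1, h2⟩ | ⟨h, h1, h2⟩ | ⟨h, h1, h2⟩ <;>
  rcases truncate_cases hM b with ⟨k, k1, k2⟩ | ⟨k, k1, k2⟩ | ⟨k, k1, k2⟩ <;>
  rw [h1, h2, k2] <;> (try rw [abs_le] at h) <;> (try rw [abs_le] at k) <;>
  constructor <;> nlinarith [sq_nonneg (b - a), sq_nonneg (b - M), sq_nonneg (b + M),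
    sq_nonneg (a - M), sq_nonneg (a + M)]

/-- Source of the small factor `M ^ (-β)` in every error term caused by truncation. -/
theorem rpow_two_add_le {M β s : ℝ} (hM : 1 ≤ M) (hβ : 0 < β) (hs : M ≤ s) :
    s ^ (2 + β) ≤ M ^ (-β) * s ^ (2 + 2 * β) := by
  have hs0 : 0 < s := by linarith
  have : s ^ (2 + 2 * β) = s ^ (2 + β) * s ^ β := by
    rw [← Real.rpow_add hs0]
    ring_nf
  rw [this, Real.rpow_neg (by linarith)]
  have h1 : M ^ β ≤ s ^ β := Real.rpow_le_rpow (by linarith) hs hβ.le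
  have h2 : 0 < M ^ β := Real.rpow_pos_of_pos (by linarith) _
  rw [inv_mul_eq_div, le_div_iff₀ h2]
  gcongr

theorem sq_le_two_mul_truncEnergy_add {M β : ℝ} (hM : 1 ≤ M) (hβ : 0 < β) (s : ℝ) :
    s ^ 2 ≤ 2 * truncEnergy M s + M ^ (-β) * |s| ^ (2 + 2 * β) := by
  have hM0 : 0 ≤ M := by linarith
  rcases truncate_eq_self_or_le hM0 s with ⟨-, h⟩ | h
  · rw [h]
    have : 0 ≤ M ^ (-β) * |s| ^ (2 + 2 * β) := by positivity
    linarith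
  · have h1 := rpow_two_add_le hM hβ h
    have h2 : |s| ^ (2 : ℝ) ≤ |s| ^ (2 + β) :=
      Real.rpow_le_rpow_of_exponent_le (hM.trans h) (by linarith)
    rw [Real.rpow_two, sq_abs] at h2
    linarith [truncEnergy_nonneg hM0 s]

theorem two_mul_truncEnergy_le {M β : ℝ} (hM : 1 ≤ M) (hβ : 0 < β) (s : ℝ) :
    2 * truncEnergy M s ≤ truncate M s ^ 2 + M ^ (-β) * |s| ^ (2 + 2 * β) := by
  have hM0 : 0 ≤ M := by linarith
  rcases truncate_eq_self_or_le hM0 s with ⟨h', h⟩ | h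
  · rw [h, h']
    have : 0 ≤ M ^ (-β) * |s| ^ (2 + 2 * β) := by positivity
    linarith
  · have h1 := rpow_two_add_le hM hβ h
    have h2 : |s| ^ (2 : ℝ) ≤ |s| ^ (2 + β) :=
      Real.rpow_le_rpow_of_exponent_le (hM.trans h) (by linarith)
    rw [Real.rpow_two, sq_abs] at h2
    have := truncEnergy_le M s
    have := sq_nonneg (truncate M s)
    linarith

/-- Dissipativity will be applied at the truncated value only; this is the cost of replacing `f s`
by `f (truncate M s)`. It vanishes unless `|s| ≥ M`, where the growth bound on `f'` gives a multiple
of `|s| ^ (2 + β)`. -/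
theorem sub_truncate_mul_le {f : ℝ → ℝ} {C β M : ℝ} (hf : ContDiff ℝ 1 f)
    (hf' : ∀ u, |deriv f u| ≤ C * (1 + |u| ^ β)) (hC : 0 ≤ C) (hβ : 0 < β) (hM : 1 ≤ M) (s : ℝ) :
    (f s - f (truncate M s)) * truncate M s ≤ 2 * C * (M ^ (-β) * |s| ^ (2 + 2 * β)) := by
  have hM0 : 0 ≤ M := by linarith
  rcases truncate_eq_self_or_le hM0 s with ⟨h', -⟩ | h
  · rw [h', sub_self, zero_mul]
    positivity
  have hs1 : 1 ≤ |s| := hM.trans h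
  have hs0 : 0 < |s| := by linarith
  have hmem (r : ℝ) (hr : |r| ≤ |s|) : r ∈ Icc (-|s|) |s| := abs_le.1 hr
  have hdiff : |f s - f (truncate M s)| ≤ C * (1 + |s| ^ β) * |s - truncate M s| :=
    Convex.norm_image_sub_le_of_norm_deriv_le (s := Icc (-|s|) |s|)
      (fun r _ => hf.differentiable one_ne_zero r)
      (fun r hr => (hf' r).trans (by
        have := abs_le.2 hr
        gcongr)) (convex_Icc _ _) (hmem _ (abs_truncate_le hM0 s)) (hmem _ le_rfl)
  have h3 : |s - truncate M s| ≤ |s| := by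
    rcases truncate_cases hM0 s with ⟨h, h1, -⟩ | ⟨h, h1, -⟩ | ⟨h, h1, -⟩ <;> rw [h1]
    · rw [abs_of_nonpos (a := s) (by linarith), abs_of_nonpos (by linarith)]
      linarith
    · simp
    · rw [abs_of_nonneg (a := s) (by linarith), abs_of_nonneg (by linarith)]
      linarith
  have h4 : 1 ≤ |s| ^ β := Real.one_le_rpow hs1 hβ.le
  calc _ ≤ |f s - f (truncate M s)| * |truncate M s| := by
        rw [← abs_mul]
        exact le_abs_self _
    _ ≤ C * (|s| ^ β + |s| ^ β) * |s| * |s| := by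
        refine mul_le_mul (hdiff.trans ?_) (abs_truncate_le hM0 s) (abs_nonneg _) (by positivity)
        gcongr
    _ = 2 * C * |s| ^ (2 + β) := by
        rw [Real.rpow_add hs0, Real.rpow_two]
        ring
    _ ≤ _ := mul_le_mul_of_nonneg_left (rpow_two_add_le hM hβ h) (by positivity)

/-- The dissipative nonlinearity tested against the truncation. -/
theorem mul_truncate_le {f : ℝ → ℝ} {C β M ν q b c : ℝ} (hf : ContDiff ℝ 1 f)
    (hf' : ∀ u, |deriv f u| ≤ C * (1 + |u| ^ β)) (hC : 0 ≤ C) (hβ : 0 < β) (hM : 1 ≤ M)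
    (hν : 0 ≤ ν) (hq : 2 ≤ q) (hq' : q ≤ 2 + 2 * β)
    (h : ∀ u, f u * u ≤ -ν * |u| ^ 2 + b * |u| ^ q + c) (s : ℝ) :
    f s * truncate M s ≤ -(2 * ν) * truncEnergy M s + M ^ (2 * β) * (|b| * truncate M s ^ 2) +
      |c| + (2 * C + ν) * (M ^ (-β) * |s| ^ (2 + 2 * β)) := by
  have hM0 : 0 ≤ M := by linarith
  have h1 := h (truncate M s)
  have h2 := sub_truncate_mul_le hf hf' hC hβ hM s
  have h3 := mul_le_mul_of_nonneg_left (two_mul_truncEnergy_le hM hβ s) hν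
  -- The excess power is at most `M ^ (q - 2) ≤ M ^ (2 * β)`, a bound free of `q`.
  have h4 : |truncate M s| ^ q ≤ M ^ (2 * β) * truncate M s ^ 2 := by
    rcases (abs_nonneg (truncate M s)).eq_or_lt with h0 | h0
    · rw [← h0, Real.zero_rpow (by linarith)]
      positivity
    · have : |truncate M s| ^ q = |truncate M s| ^ (q - 2) * truncate M s ^ 2 := by
        rw [← sq_abs (truncate M s), ← Real.rpow_two, ← Real.rpow_add h0]
        ring_nf
      rw [this]
      gcongr
      calc _ ≤ M ^ (q - 2) :=
            Real.rpow_le_rpow h0.le (abs_truncate_le_level hM0 s) (by linarith)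
        _ ≤ _ := Real.rpow_le_rpow_of_exponent_le hM (by linarith)
  have h5 : b * |truncate M s| ^ q ≤ |b| * (M ^ (2 * β) * truncate M s ^ 2) :=
    mul_le_mul (le_abs_self b) h4 (by positivity) (abs_nonneg b)
  rw [sq_abs] at h1
  nlinarith [le_abs_self c]

/-- Where `|b| ≤ δ` the term is absorbed by `δ * s ^ 2`; where `|b| ≥ δ`, `|b| ≤ δ ^ (1 - p) * |b| ^
p` and the truncation is bounded by `M`. No relation between `p` and `q` is required. -/
theorem abs_mul_truncate_sq_le {M δ p b : ℝ} (hM : 0 ≤ M) (hδ : 0 < δ) (hp : 1 ≤ p) (s : ℝ) :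
    |b| * truncate M s ^ 2 ≤ δ * s ^ 2 + M ^ 2 * δ ^ (1 - p) * |b| ^ p := by
  have h1 : truncate M s ^ 2 ≤ s ^ 2 := sq_le_sq.2 (abs_truncate_le hM s)
  have h2 : truncate M s ^ 2 ≤ M ^ 2 := sq_le_sq.2 (by
    rw [abs_of_nonneg hM]
    exact abs_truncate_le_level hM s)
  have h0 : 0 ≤ M ^ 2 * δ ^ (1 - p) * |b| ^ p := by positivity
  rcases le_total |b| δ with h | h
  · nlinarith [mul_le_mul h h1 (sq_nonneg _) hδ.le]
  · have hb : 0 < |b| := by linarith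
    have h3 : |b| ≤ δ ^ (1 - p) * |b| ^ p := by
      have e : |b| = |b| ^ (1 - p) * |b| ^ p := by
        rw [← Real.rpow_add hb]
        simp
      calc |b| = |b| ^ (1 - p) * |b| ^ p := e
        _ ≤ _ := by
          gcongr ?_ * _
          exact Real.rpow_le_rpow_of_nonpos hδ h (by linarith)
    have := mul_le_mul h3 h2 (sq_nonneg _) (by positivity)
    nlinarith [mul_nonneg hδ.le (sq_nonneg s)]

/-! ### The localized energy and its differential inequality -/

theorem memLp_weighted_truncate {n : ℕ} {ψ : EuclideanSpace ℝ (Fin n) → ℝ} (hψ : Continuous ψ)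
    (hψ1 : ∀ x, |ψ x| ≤ 1) {M : ℝ} (hM : 0 ≤ M) (u : L2 n) :
    MemLp (fun x => ψ x * truncate M (u x)) 2 volume := by
  refine (Lp.memLp u).mono (hψ.aestronglyMeasurable.mul
    ((continuous_truncate M).comp_aestronglyMeasurable (Lp.aestronglyMeasurable u)))
    (Eventually.of_forall fun x => ?_)
  rw [norm_mul]
  exact (mul_le_of_le_one_left (norm_nonneg _) (hψ1 x)).trans (abs_truncate_le hM _)

theorem integrable_weighted_truncEnergy {n : ℕ} {ψ : EuclideanSpace ℝ (Fin n) → ℝ}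
    (hψ : Continuous ψ) (hψ1 : ∀ x, |ψ x| ≤ 1) {M : ℝ} (hM : 0 ≤ M) (u : L2 n) :
    Integrable (fun x => ψ x * truncEnergy M (u x)) := by
  refine (L2_integrable_sq u).mono (hψ.aestronglyMeasurable.mul
    ((continuous_truncEnergy M).comp_aestronglyMeasurable (Lp.aestronglyMeasurable u)))
    (Eventually.of_forall fun x => ?_)
  rw [norm_mul]
  refine (mul_le_of_le_one_left (norm_nonneg _) (hψ1 x)).trans ?_
  rw [Real.norm_of_nonneg (truncEnergy_nonneg hM _), Real.norm_of_nonneg (sq_nonneg _)]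
  linarith [truncEnergy_le M (u x), sq_nonneg (u x)]

theorem hasFDerivAt_weighted_truncEnergy {n : ℕ} {ψ : EuclideanSpace ℝ (Fin n) → ℝ}
    (hψ : Continuous ψ) (hψ1 : ∀ x, |ψ x| ≤ 1) {M : ℝ} (hM : 0 ≤ M) (u : L2 n) :
    HasFDerivAt (fun u : L2 n => ∫ x, ψ x * truncEnergy M (u x))
      (innerSL ℝ (memLp_weighted_truncate hψ hψ1 hM u).toLp) u := by
  set g := (memLp_weighted_truncate hψ hψ1 hM u).toLp with hg
  have hgae : g =ᵐ[volume] fun x => ψ x * truncate M (u x) := MemLp.coeFn_toLp _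
  have hbound (w : L2 n) : ‖(∫ x, ψ x * truncEnergy M (w x)) -
      (∫ x, ψ x * truncEnergy M (u x)) - ⟪g, w - u⟫_ℝ‖ ≤ ‖w - u‖ ^ 2 := by
    have hdiff : Integrable fun x => ψ x * truncEnergy M (w x) - ψ x * truncEnergy M (u x) :=
      (integrable_weighted_truncEnergy hψ hψ1 hM w).sub
        (integrable_weighted_truncEnergy hψ hψ1 hM u)
    rw [L2_inner_eq, ← integral_sub (integrable_weighted_truncEnergy hψ hψ1 hM w)
      (integrable_weighted_truncEnergy hψ hψ1 hM u), ← integral_sub hdiff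
      (L2_integrable_mul _ _), L2_norm_sq_eq]
    refine norm_integral_le_of_norm_le (L2_integrable_sq (w - u)) ?_
    filter_upwards [hgae, Lp.coeFn_sub w u] with x h1 h2
    rw [h1, h2, Pi.sub_apply]
    have : ψ x * truncEnergy M (w x) - ψ x * truncEnergy M (u x) -
        ψ x * truncate M (u x) * (w x - u x) = ψ x * (truncEnergy M (w x) - truncEnergy M (u x) -
          truncate M (u x) * (w x - u x)) := by ring
    rw [this, norm_mul]
    exact (mul_le_of_le_one_left (norm_nonneg _) (hψ1 x)).trans (abs_truncEnergy_sub_le hM _ _)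
  have hsmall : HasFDerivAt (fun w : L2 n => (∫ x, ψ x * truncEnergy M (w x)) -
      (∫ x, ψ x * truncEnergy M (u x)) - ⟪g, w - u⟫_ℝ) (0 : L2 n →L[ℝ] ℝ) u := by
    refine Asymptotics.IsBigO.hasFDerivAt (n := 2) (Asymptotics.IsBigO.of_bound 1
      (Eventually.of_forall fun w => ?_)) one_lt_two
    simpa using hbound w
  have hlin : HasFDerivAt (fun w : L2 n => ⟪g, w - u⟫_ℝ) (innerSL ℝ g) u := by
    simpa [inner_sub_right] using ((innerSL ℝ g).hasFDerivAt (x := u)).sub_const ⟪g, u⟫_ℝ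
  have := (hsmall.add hlin).add_const (∫ x, ψ x * truncEnergy M (u x))
  rw [zero_add] at this
  refine this.congr_of_eventuallyEq (Eventually.of_forall fun w => ?_)
  simp

/-- Gronwall: `(E - η / a) * exp (a * s)` is nonincreasing. Differentiability is asked only on the
open interval, as for a solution. -/
theorem le_exp_of_deriv_le {T a η : ℝ} {E E' : ℝ → ℝ} (ha : 0 < a) (hη : 0 ≤ η)
    (hc : ContinuousOn E (Icc 0 T)) (hd : ∀ t ∈ Ioo 0 T, HasDerivAt E (E' t) t)
    (hle : ∀ t ∈ Ioo 0 T, E' t ≤ -a * E t + η) {t : ℝ} (ht : t ∈ Icc 0 T) :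
    E t ≤ E 0 * Real.exp (-a * t) + η / a := by
  have hexp (s : ℝ) : HasDerivAt (fun s => Real.exp (a * s)) (Real.exp (a * s) * a) s := by
    simpa using ((hasDerivAt_id s).const_mul a).exp
  have hder (s : ℝ) (hs : s ∈ Ioo 0 T) : HasDerivAt (fun s => (E s - η / a) * Real.exp (a * s))
      (E' s * Real.exp (a * s) + (E s - η / a) * (Real.exp (a * s) * a)) s :=
    ((hd s hs).sub_const _).mul (hexp s)
  have hanti : AntitoneOn (fun s => (E s - η / a) * Real.exp (a * s)) (Icc 0 T) := by
    refine antitoneOn_of_deriv_nonpos (convex_Icc 0 T)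
      ((hc.sub continuousOn_const).mul (by fun_prop)) ?_ ?_ <;> rw [interior_Icc]
    · exact fun s hs => (hder s hs).differentiableAt.differentiableWithinAt
    · intro s hs
      rw [(hder s hs).deriv]
      have : E' s * Real.exp (a * s) + (E s - η / a) * (Real.exp (a * s) * a) =
          (E' s - (-a * E s + η)) * Real.exp (a * s) := by
        field_simp
        ring
      rw [this]
      exact mul_nonpos_of_nonpos_of_nonneg (by linarith [hle s hs]) (Real.exp_pos _).le
  have h0 := hanti (left_mem_Icc.2 (ht.1.trans ht.2)) ht ht.1
  simp only [mul_zero, Real.exp_zero, mul_one] at h0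
  have hpos : 0 ≤ η / a := div_nonneg hη ha.le
  have hlast : E t - η / a ≤ (E 0 - η / a) * Real.exp (-a * t) := by
    rw [neg_mul, Real.exp_neg, ← div_eq_mul_inv, le_div_iff₀ (Real.exp_pos _)]
    exact h0
  nlinarith [mul_nonneg hpos (Real.exp_pos (-a * t)).le]

/-- The differential inequality for the localized truncated energy. -/
theorem inner_weighted_truncate_le {n : ℕ} {F : EuclideanSpace ℝ (Fin n) → ℝ → ℝ}
    {R C ν q p p₀ β L M δ S : ℝ} {b c ψ : EuclideanSpace ℝ (Fin n) → ℝ}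
    {A : Set (EuclideanSpace ℝ (Fin n))} (hC : 0 ≤ C) (hν : 0 ≤ ν)
    (hβ : 0 < β) (hβn : β = 2 / ((n : ℝ) - 2)) (hq' : q ≤ 2 + 2 * β)
    (hF : GrowthCondition F C) (hD : DissipativeCondition F ν q p b c)
    (hψ : Continuous ψ) (hψ0 : ∀ x, 0 ≤ ψ x) (hψ1 : ∀ x, ψ x ≤ 1)
    (hL : ∀ x y, |ψ x - ψ y| ≤ L * ‖x - y‖) (hA : MeasurableSet A) (hψA : ∀ x ∉ A, ψ x = 0)
    (hp₀ : 1 ≤ p₀) (hb : Integrable fun x => |b x| ^ p₀) (hM : 1 ≤ M) (hδ : 0 < δ)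
    {u : H1 n} {v w g : L2 n} (hR : ‖u‖ ≤ R) (hw : IsNegLaplacian u w)
    (heq : (v + w : L2 n) =ᵐ[volume] fun x => F x (u.fn x))
    (hSi : Integrable fun x => |u.fn x| ^ (2 + 2 * β))
    (hS : ∫ x, |u.fn x| ^ (2 + 2 * β) ≤ S)
    (hg : g =ᵐ[volume] fun x => ψ x * truncate M (u.fn x)) :
    ⟪g, v⟫_ℝ ≤ -(2 * ν) * (∫ x, ψ x * truncEnergy M (u.fn x)) +
      (M ^ (2 * β) * (δ * R ^ 2 + M ^ 2 * δ ^ (1 - p₀) * ∫ x in A, |b x| ^ p₀) +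
        (∫ x in A, |c x|) + (2 * C + ν) * (M ^ (-β) * S) + n * (L * R ^ 2)) := by
  have hM0 : 0 ≤ M := by linarith
  have hR0 : 0 ≤ R := (norm_nonneg _).trans hR
  have hψabs (x) : |ψ x| ≤ 1 := by
    rw [abs_of_nonneg (hψ0 x)]
    exact hψ1 x
  obtain ⟨D, hD2, rfl⟩ := hw
  have hlap : ⟪g, ∑ i, D i i⟫_ℝ ≤ n * (L * R ^ 2) := by
    rw [inner_sum]
    calc _ ≤ ∑ _i : Fin n, L * R ^ 2 := by
          refine Finset.sum_le_sum fun i _ => ?_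
          rw [real_inner_comm]
          refine ((u.hasWeakPartial i).inner_second_partial_le (hD2 i i) hg hψ0 hL
            (truncate_mono M) (abs_truncate_le hM0)).trans ?_
          have hL0 : 0 ≤ L := by
            have := (abs_nonneg _).trans (hL (EuclideanSpace.single i 1) 0)
            simpa using this
          rw [mul_assoc, sq]
          gcongr
          · exact u.norm_fn_le.trans hR
          · exact (u.norm_grad_le i).trans hR
      _ = _ := by simp
  -- The equation identifies `v - ∑ D i i` with `F(x, u)`, so the time derivative is the reaction
  -- term plus the Laplacian.
  have hsplit : ⟪g, v⟫_ℝ = ⟪g, v + -∑ i, D i i⟫_ℝ + ⟪g, ∑ i, D i i⟫_ℝ := by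
    rw [← inner_add_right]
    congr 1
    abel
  have hbA := hb.indicator hA
  have hcA := hD.integrable_c.abs.indicator hA
  have hE := integrable_weighted_truncEnergy hψ hψabs hM0 u.fn
  have hu2 := L2_integrable_sq u.fn
  set r : EuclideanSpace ℝ (Fin n) → ℝ := fun x =>
    -(2 * ν) * (ψ x * truncEnergy M (u.fn x)) + (M ^ (2 * β) * (δ * u.fn x ^ 2 +
      M ^ 2 * δ ^ (1 - p₀) * A.indicator (fun x => |b x| ^ p₀) x) +
      A.indicator (fun x => |c x|) x + (2 * C + ν) * (M ^ (-β) * |u.fn x| ^ (2 + 2 * β)))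
    with hr
  have i1 := hE.const_mul (-(2 * ν))
  have i2 := ((hu2.const_mul δ).add (hbA.const_mul (M ^ 2 * δ ^ (1 - p₀)))).const_mul (M ^ (2 * β))
  have i3 := (hSi.const_mul (M ^ (-β))).const_mul (2 * C + ν)
  have hri : Integrable r := i1.add ((i2.add hcA).add i3)
  have hrint : ∫ x, r x = -(2 * ν) * (∫ x, ψ x * truncEnergy M (u.fn x)) +
      (M ^ (2 * β) * (δ * (∫ x, u.fn x ^ 2) + M ^ 2 * δ ^ (1 - p₀) * ∫ x in A, |b x| ^ p₀) +
        (∫ x in A, |c x|) + (2 * C + ν) * (M ^ (-β) * ∫ x, |u.fn x| ^ (2 + 2 * β))) := by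
    have e1 := integral_add i1 ((i2.add hcA).add i3)
    have e2 := integral_add (i2.add hcA) i3
    have e3 := integral_add i2 hcA
    have e4 := integral_add (hu2.const_mul δ) (hbA.const_mul (M ^ 2 * δ ^ (1 - p₀)))
    simp only [Pi.add_apply, integral_const_mul, integral_indicator hA] at e1 e2 e3 e4
    simp only [hr]
    rw [e1, e2, e3, e4]
  have hmain : ⟪g, v + -∑ i, D i i⟫_ℝ ≤ ∫ x, r x := by
    rw [L2_inner_eq_of_ae hg heq]
    refine integral_mono_ae ?_ hri ?_
    · have := L2_integrable_mul g (v + -∑ i, D i i)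
      refine this.congr ?_
      filter_upwards [hg, heq] with x h1 h2
      rw [h1, h2]
    · filter_upwards [hD.mul_le] with x hx
      have hpt := mul_truncate_le (hF.contDiff x) (fun s => by
        rw [hβn]
        exact hF.deriv_le x s) hC hβ hM hν hD.two_le_q hq' hx (u.fn x)
      have hbt := abs_mul_truncate_sq_le (b := b x) hM0 hδ hp₀ (u.fn x)
      -- The weight is kept on the dissipative term, to recover the energy, and dropped from the
      -- nonnegative errors. Off `A` it vanishes, so `b` and `c` enter only through their integrals
      -- over `A`.
      by_cases hxA : x ∈ A
      · simp only [hr, indicator_of_mem hxA]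
        have hMb : 0 ≤ M ^ (2 * β) := by positivity
        have hbt' := mul_le_mul_of_nonneg_left hbt hMb
        have hrest : 0 ≤ M ^ (2 * β) * (δ * u.fn x ^ 2 + M ^ 2 * δ ^ (1 - p₀) * |b x| ^ p₀) +
            |c x| + (2 * C + ν) * (M ^ (-β) * |u.fn x| ^ (2 + 2 * β)) := by positivity
        calc ψ x * truncate M (u.fn x) * F x (u.fn x) =
            ψ x * (F x (u.fn x) * truncate M (u.fn x)) := by ring
          _ ≤ ψ x * (-(2 * ν) * truncEnergy M (u.fn x) + (M ^ (2 * β) * (δ * u.fn x ^ 2 +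
              M ^ 2 * δ ^ (1 - p₀) * |b x| ^ p₀) +
              |c x| + (2 * C + ν) * (M ^ (-β) * |u.fn x| ^ (2 + 2 * β)))) :=
            mul_le_mul_of_nonneg_left (by linarith) (hψ0 x)
          _ ≤ _ := by
            rw [mul_add]
            have := mul_le_of_le_one_left hrest (hψ1 x)
            linarith
      · simp only [hr, indicator_of_notMem hxA, hψA x hxA]
        simp only [zero_mul, mul_zero, zero_add, add_zero]
        positivity
  have hu2R : ∫ x, u.fn x ^ 2 ≤ R ^ 2 := by
    rw [← L2_norm_sq_eq]
    have := u.norm_fn_le.trans hR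
    gcongr
  rw [hrint] at hmain
  rw [hsplit]
  have : M ^ (2 * β) * (δ * (∫ x, u.fn x ^ 2) + M ^ 2 * δ ^ (1 - p₀) * ∫ x in A, |b x| ^ p₀) +
        (∫ x in A, |c x|) + (2 * C + ν) * (M ^ (-β) * ∫ x, |u.fn x| ^ (2 + 2 * β)) ≤
      M ^ (2 * β) * (δ * R ^ 2 + M ^ 2 * δ ^ (1 - p₀) * ∫ x in A, |b x| ^ p₀) +
        (∫ x in A, |c x|) + (2 * C + ν) * (M ^ (-β) * S) := by
    gcongr
  linarith

theorem IsSolution.tail_le {n : ℕ} {F : EuclideanSpace ℝ (Fin n) → ℝ → ℝ}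
    {R C ν q p p₀ β L M δ S T : ℝ} {b c ψ : EuclideanSpace ℝ (Fin n) → ℝ}
    {A B : Set (EuclideanSpace ℝ (Fin n))} {u : ℝ → H1 n} (hC : 0 ≤ C) (hν : 0 < ν)
    (hβ : 0 < β) (hβn : β = 2 / ((n : ℝ) - 2)) (hq' : q ≤ 2 + 2 * β)
    (hF : GrowthCondition F C) (hD : DissipativeCondition F ν q p b c)
    (hψ : Continuous ψ) (hψ0 : ∀ x, 0 ≤ ψ x) (hψ1 : ∀ x, ψ x ≤ 1) (hL0 : 0 ≤ L)
    (hL : ∀ x y, |ψ x - ψ y| ≤ L * ‖x - y‖) (hA : MeasurableSet A) (hψA : ∀ x ∉ A, ψ x = 0)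
    (hB : MeasurableSet B) (hψB : ∀ x ∈ B, ψ x = 1)
    (hp₀ : 1 ≤ p₀) (hb : Integrable fun x => |b x| ^ p₀) (hM : 1 ≤ M) (hδ : 0 < δ)
    (hu : IsSolution F T u) (hR : ∀ t ∈ Icc 0 T, ‖u t‖ ≤ R)
    (hSi : ∀ v : H1 n, Integrable fun x => |v.fn x| ^ (2 + 2 * β))
    (hS : ∀ v : H1 n, ‖v‖ ≤ R → ∫ x, |v.fn x| ^ (2 + 2 * β) ≤ S) {t : ℝ} (ht : t ∈ Icc 0 T) :
    ∫ x in B, |(u t).fn x| ^ 2 ≤ R ^ 2 * Real.exp (-2 * ν * t) +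
      ((M ^ (2 * β) * (δ * R ^ 2 + M ^ 2 * δ ^ (1 - p₀) * ∫ x in A, |b x| ^ p₀) +
        (∫ x in A, |c x|) + (2 * C + ν) * (M ^ (-β) * S) + n * (L * R ^ 2)) / ν +
        M ^ (-β) * S) := by
  have hM0 : 0 ≤ M := by linarith
  have hψabs (x) : |ψ x| ≤ 1 := by
    rw [abs_of_nonneg (hψ0 x)]
    exact hψ1 x
  have h0T : (0 : ℝ) ∈ Icc 0 T := left_mem_Icc.2 (ht.1.trans ht.2)
  have hS0 : 0 ≤ S := (integral_nonneg fun x => by positivity).trans (hS _ (hR t ht))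
  have hbA : 0 ≤ ∫ x in A, |b x| ^ p₀ := integral_nonneg fun x => by positivity
  have hcA : 0 ≤ ∫ x in A, |c x| := integral_nonneg fun x => by positivity
  set η := M ^ (2 * β) * (δ * R ^ 2 + M ^ 2 * δ ^ (1 - p₀) * ∫ x in A, |b x| ^ p₀) +
    (∫ x in A, |c x|) + (2 * C + ν) * (M ^ (-β) * S) + n * (L * R ^ 2) with hη
  have hη0 : 0 ≤ η := by positivity
  set J : L2 n → ℝ := fun v => ∫ x, ψ x * truncEnergy M (v x) with hJ
  have hfn : Continuous fun v : H1 n => v.fn :=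
    (WithLp.prod_continuous_ofLp 2 (L2 n) (PiLp 2 fun _ : Fin n => L2 n)).fst.comp
      continuous_subtype_val
  have hcont : ContinuousOn (fun s => J (u s).fn) (Icc 0 T) :=
    (continuous_iff_continuousAt.2 fun v =>
      (hasFDerivAt_weighted_truncEnergy hψ hψabs hM0 v).continuousAt).comp_continuousOn
      (hfn.comp_continuousOn hu.1)
  choose! v w hv hw heq using hu.2
  have hgron := le_exp_of_deriv_le (E := fun s => J (u s).fn)
    (E' := fun s => ⟪(memLp_weighted_truncate hψ hψabs hM0 (u s).fn).toLp, v s⟫_ℝ)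
    (a := 2 * ν) (η := η) (by positivity) hη0 hcont
    (fun s hs => (hasFDerivAt_weighted_truncEnergy hψ hψabs hM0 _).comp_hasDerivAt s (hv s hs))
    (fun s hs => inner_weighted_truncate_le hC hν.le hβ hβn hq' hF hD hψ hψ0 hψ1 hL hA hψA hp₀ hb
      hM hδ (hR s (Ioo_subset_Icc_self hs)) (hw s hs) (heq s hs) (hSi _)
      (hS _ (hR s (Ioo_subset_Icc_self hs))) (MemLp.coeFn_toLp _)) ht
  have hJ0 : 2 * J (u 0).fn ≤ R ^ 2 := by
    have h1 : J (u 0).fn ≤ ∫ x, (u 0).fn x ^ 2 / 2 := by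
      refine integral_mono (integrable_weighted_truncEnergy hψ hψabs hM0 _)
        ((L2_integrable_sq _).div_const 2) fun x => ?_
      exact (mul_le_of_le_one_left (truncEnergy_nonneg hM0 _) (hψ1 x)).trans (truncEnergy_le M _)
    rw [integral_div, ← L2_norm_sq_eq] at h1
    have h2 : ‖(u 0).fn‖ ^ 2 ≤ R ^ 2 := by
      have := (u 0).norm_fn_le.trans (hR 0 h0T)
      gcongr
    linarith
  -- On `B` the weight is `1`, and twice the truncated energy misses `u²` only by the
  -- Sobolev-controlled error.
  have hJt : ∫ x in B, |(u t).fn x| ^ 2 ≤ 2 * J (u t).fn + M ^ (-β) * S := by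
    rw [← integral_indicator hB]
    have hE := (integrable_weighted_truncEnergy hψ hψabs hM0 (u t).fn).const_mul 2
    have hW := (hSi (u t)).const_mul (M ^ (-β))
    have h1 : ∫ x, B.indicator (fun x => |(u t).fn x| ^ 2) x ≤
        ∫ x, (2 * (ψ x * truncEnergy M ((u t).fn x)) +
          M ^ (-β) * |(u t).fn x| ^ (2 + 2 * β)) := by
      refine integral_mono ?_ (hE.add hW) fun x => ?_
      · simp only [sq_abs]
        exact (L2_integrable_sq _).indicator hB
      · by_cases hx : x ∈ B
        · simp only [indicator_of_mem hx, hψB x hx, one_mul, sq_abs]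
          exact sq_le_two_mul_truncEnergy_add hM hβ _
        · simp only [indicator_of_notMem hx]
          have := mul_nonneg (hψ0 x) (truncEnergy_nonneg hM0 ((u t).fn x))
          positivity
    rw [integral_add hE hW, integral_const_mul, integral_const_mul] at h1
    have := mul_le_mul_of_nonneg_left (hS _ (hR t ht)) (Real.rpow_nonneg hM0 (-β))
    linarith
  have hexp : 2 * J (u 0).fn * Real.exp (-2 * ν * t) ≤ R ^ 2 * Real.exp (-2 * ν * t) := by
    gcongr
  have hrw : -(2 * ν) * t = -2 * ν * t := by ring
  rw [hrw] at hgron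
  have hdiv : 2 * (η / (2 * ν)) = η / ν := by field_simp
  linarith

/-! ### Uniform smallness of the tails -/

theorem H1.exists_integral_rpow_le (n : ℕ) (hn : 3 ≤ n) (R : ℝ) {β : ℝ}
    (hβn : β = 2 / ((n : ℝ) - 2)) : ∃ S : ℝ,
    (∀ v : H1 n, Integrable fun x => |v.fn x| ^ (2 + 2 * β)) ∧
    ∀ v : H1 n, ‖v‖ ≤ R → ∫ x, |v.fn x| ^ (2 + 2 * β) ≤ S := by
  have hn' : (3 : ℝ) ≤ n := by exact_mod_cast hn
  have hn2 : (n : ℝ) - 2 ≠ 0 := by linarith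
  have hr : 2 * (n : ℝ) / (n - 2) = 2 + 2 * β := by
    rw [hβn]
    field_simp
    ring
  have hβ : 0 < β := by
    rw [hβn]
    exact div_pos two_pos (by linarith)
  obtain ⟨K, hK, h⟩ := H1.exists_eLpNorm_le n hn
  rw [hr] at h
  have hr0 : ENNReal.ofReal (2 + 2 * β) ≠ 0 := by
    rw [Ne, ENNReal.ofReal_eq_zero]
    linarith
  have hmem (v : H1 n) : MemLp v.fn (ENNReal.ofReal (2 + 2 * β)) volume :=
    ⟨Lp.aestronglyMeasurable _, (h v).trans_lt ENNReal.ofReal_lt_top⟩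
  have htoReal : (ENNReal.ofReal (2 + 2 * β)).toReal = 2 + 2 * β :=
    ENNReal.toReal_ofReal (by linarith)
  refine ⟨(K * R) ^ (2 + 2 * β), fun v => ?_, fun v hv => ?_⟩
  · have := (hmem v).integrable_norm_rpow hr0 ENNReal.ofReal_ne_top
    rwa [htoReal] at this
  · have h1 := h v
    rw [(hmem v).eLpNorm_eq_integral_rpow_norm hr0 ENNReal.ofReal_ne_top, htoReal,
      ENNReal.ofReal_le_ofReal_iff (by positivity),
      Real.rpow_inv_le_iff_of_pos (integral_nonneg fun x => by positivity) (by positivity)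
        (by linarith)] at h1
    refine h1.trans ?_
    gcongr

theorem tendsto_setIntegral_norm_ge {n : ℕ} {f : EuclideanSpace ℝ (Fin n) → ℝ}
    (hf : Integrable f) :
    Tendsto (fun k : ℕ => ∫ x in {x | (k : ℝ) / 2 ≤ ‖x‖}, f x) atTop (𝓝 0) := by
  have hms (k : ℕ) : MeasurableSet {x : EuclideanSpace ℝ (Fin n) | (k : ℝ) / 2 ≤ ‖x‖} :=
    measurableSet_le measurable_const measurable_norm
  have := tendsto_setIntegral_of_antitone hms (f := f) (μ := volume) (fun i j hij x hx => by
    have : (i : ℝ) ≤ j := by exact_mod_cast hij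
    have hx' : (j : ℝ) / 2 ≤ ‖x‖ := hx
    change (i : ℝ) / 2 ≤ ‖x‖
    linarith) ⟨0, hf.integrableOn⟩
  have hempty : ⋂ k : ℕ, {x : EuclideanSpace ℝ (Fin n) | (k : ℝ) / 2 ≤ ‖x‖} = ∅ := by
    refine eq_empty_of_forall_notMem fun x hx => ?_
    obtain ⟨k, hk⟩ := exists_nat_gt (2 * ‖x‖)
    have h1 : (k : ℝ) / 2 ≤ ‖x‖ := mem_iInter.1 hx k
    linarith
  simpa [hempty] using this

/-- A Lipschitz radial cutoff, equal to `0` for `‖x‖ ≤ k / 2` and to `1` for `k ≤ ‖x‖`. -/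
def outerCutoff {n : ℕ} (k : ℝ) (x : EuclideanSpace ℝ (Fin n)) : ℝ :=
  max 0 (min (2 / k * ‖x‖ - 1) 1)

theorem abs_outerCutoff_sub_le {n : ℕ} {k : ℝ} (hk : 0 < k) (x y : EuclideanSpace ℝ (Fin n)) :
    |outerCutoff k x - outerCutoff k y| ≤ 2 / k * ‖x - y‖ := by
  calc _ ≤ |(min (2 / k * ‖x‖ - 1) 1) - (min (2 / k * ‖y‖ - 1) 1)| := by
        simpa [outerCutoff] using abs_max_sub_max_le_max 0 (min (2 / k * ‖x‖ - 1) 1) 0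
          (min (2 / k * ‖y‖ - 1) 1)
    _ ≤ |(2 / k * ‖x‖ - 1) - (2 / k * ‖y‖ - 1)| := by
        simpa using abs_min_sub_min_le_max (2 / k * ‖x‖ - 1) 1 (2 / k * ‖y‖ - 1) 1
    _ = 2 / k * |‖x‖ - ‖y‖| := by
        rw [sub_sub_sub_cancel_right, ← mul_sub, abs_mul, abs_of_pos (by positivity)]
    _ ≤ _ := by
        gcongr
        exact abs_norm_sub_norm_le x y

theorem DissipativeCondition.one_le_p {n : ℕ} (hn : 3 ≤ n)
    {F : EuclideanSpace ℝ (Fin n) → ℝ → ℝ} {ν q p : ℝ} {b c : EuclideanSpace ℝ (Fin n) → ℝ}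
    (h : DissipativeCondition F ν q p b c) : 1 ≤ p := by
  have hn' : (3 : ℝ) ≤ n := by exact_mod_cast hn
  refine le_trans ?_ h.le_p
  have h1 := h.q_lt
  rw [lt_div_iff₀ (by linarith)] at h1
  rw [le_div_iff₀ (by linarith)]
  nlinarith [h.two_le_q]

theorem exists_tail_bound {n : ℕ} (hn : 3 ≤ n) (R : ℝ) {C ν : ℝ} (hC : 0 ≤ C) (hν : 0 < ν)
    (b c : EuclideanSpace ℝ (Fin n) → ℝ) {ε : ℝ} (hε : 0 < ε) :
    ∃ k₀ : ℕ, ∀ k ≥ k₀, ∀ (F : EuclideanSpace ℝ (Fin n) → ℝ → ℝ) (q p T : ℝ) (u : ℝ → H1 n),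
      GrowthCondition F C → DissipativeCondition F ν q p b c →
      IsSolution F T u → (∀ t ∈ Icc 0 T, ‖u t‖ ≤ R) → ∀ t ∈ Icc 0 T,
        ∫ x in {x : EuclideanSpace ℝ (Fin n) | (k : ℝ) ≤ ‖x‖}, |(u t).fn x| ^ 2 ≤
          R ^ 2 * Real.exp (-2 * ν * t) + ε := by
  -- The exponent `p₀` must not vary with `F`: it is taken from any one admissible triple. If there
  -- is none, the claim is vacuous.
  by_cases hex : ∃ F q p, DissipativeCondition (n := n) F ν q p b c
  swap
  · exact ⟨0, fun k _ F q p _ _ _ hD => (hex ⟨F, q, p, hD⟩).elim⟩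
  obtain ⟨F₀, q₀, p₀, hD₀⟩ := hex
  have hn' : (3 : ℝ) ≤ n := by exact_mod_cast hn
  have hp₀ : 1 ≤ p₀ := hD₀.one_le_p hn
  have hb : Integrable fun x => |b x| ^ p₀ := by
    have := hD₀.memLp_b.integrable_norm_rpow
      (by rw [Ne, ENNReal.ofReal_eq_zero]; linarith) ENNReal.ofReal_ne_top
    rwa [ENNReal.toReal_ofReal (by linarith)] at this
  obtain ⟨β, hβn⟩ : ∃ β : ℝ, β = 2 / ((n : ℝ) - 2) := ⟨_, rfl⟩
  have hβ : 0 < β := by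
    rw [hβn]
    exact div_pos two_pos (by linarith)
  obtain ⟨S, hSi, hS⟩ := H1.exists_integral_rpow_le n hn R hβn
  -- The order of choice matters: `M` handles the truncation error, then `δ` beats the factor `M ^
  -- (2 * β)`, and finally `k` makes the tails of `|b| ^ p₀` and `|c|` and the slope `2 / k` small
  -- for these `M` and `δ`.
  obtain ⟨M, hM, hMε⟩ : ∃ M : ℝ, 1 ≤ M ∧
      (2 * C + ν) * (M ^ (-β) * S) / ν + M ^ (-β) * S < ε / 3 := by
    have h1 : Tendsto (fun M : ℝ => (2 * C + ν) * (M ^ (-β) * S) / ν + M ^ (-β) * S) atTop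
        (𝓝 ((2 * C + ν) * (0 * S) / ν + 0 * S)) :=
      ((((tendsto_rpow_neg_atTop hβ).mul_const S).const_mul _).div_const ν).add
        ((tendsto_rpow_neg_atTop hβ).mul_const S)
    rw [zero_mul, mul_zero, zero_div, add_zero] at h1
    exact ((eventually_ge_atTop 1).and (h1.eventually_lt_const (by positivity))).exists
  obtain ⟨δ, hδ, hδε⟩ : ∃ δ : ℝ, 0 < δ ∧ M ^ (2 * β) * (δ * R ^ 2) / ν < ε / 3 := by
    have h1 : Tendsto (fun δ : ℝ => M ^ (2 * β) * (δ * R ^ 2) / ν) (𝓝[>] 0)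
        (𝓝 (M ^ (2 * β) * (0 * R ^ 2) / ν)) :=
      tendsto_nhdsWithin_of_tendsto_nhds (Continuous.tendsto (by fun_prop) 0)
    rw [zero_mul, mul_zero, zero_div] at h1
    exact (eventually_mem_nhdsWithin.and (h1.eventually_lt_const (by positivity))).exists
  have hlim : Tendsto (fun k : ℕ => (M ^ (2 * β) * (M ^ 2 * δ ^ (1 - p₀) *
      ∫ x in {x : EuclideanSpace ℝ (Fin n) | (k : ℝ) / 2 ≤ ‖x‖}, |b x| ^ p₀) +
      (∫ x in {x : EuclideanSpace ℝ (Fin n) | (k : ℝ) / 2 ≤ ‖x‖}, |c x|) +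
      n * (2 / (k : ℝ) * R ^ 2)) / ν) atTop
      (𝓝 ((M ^ (2 * β) * (M ^ 2 * δ ^ (1 - p₀) * 0) + 0 + n * (0 * R ^ 2)) / ν)) :=
    (((((tendsto_setIntegral_norm_ge hb).const_mul _).const_mul _).add
      (tendsto_setIntegral_norm_ge hD₀.integrable_c.abs)).add
      (((tendsto_const_div_atTop_nhds_zero_nat 2).mul_const _).const_mul _)).div_const ν
  simp only [mul_zero, zero_mul, add_zero, zero_div] at hlim
  obtain ⟨k₁, hk₁⟩ := eventually_atTop.1 (hlim.eventually_lt_const (show 0 < ε / 3 by positivity))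
  -- The `1` guarantees `k > 0`, needed for the cutoff.
  refine ⟨max k₁ 1, fun k hk F q p T u hF hD hu hR t ht => ?_⟩
  have hkε := hk₁ k ((le_max_left _ _).trans hk)
  have hk0 : (0 : ℝ) < k := by
    have : 1 ≤ k := (le_max_right _ _).trans hk
    exact_mod_cast this
  have hq' : q ≤ 2 + 2 * β := by
    refine hD.q_lt.le.trans_eq ?_
    have : (n : ℝ) - 2 ≠ 0 := by linarith
    rw [hβn]
    field_simp
    ring
  refine (hu.tail_le (ψ := outerCutoff k) (A := {x | (k : ℝ) / 2 ≤ ‖x‖}) (L := 2 / k) hC hν hβ hβn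
    hq' hF hD ?_ (fun x => le_max_left _ _) (fun x => max_le zero_le_one (min_le_right _ _))
    (by positivity) (abs_outerCutoff_sub_le hk0)
    (measurableSet_le measurable_const measurable_norm) ?_
    (measurableSet_le measurable_const measurable_norm) ?_ hp₀ hb hM hδ hR hSi hS ht).trans ?_
  · unfold outerCutoff
    fun_prop
  · intro x hx
    have hx' : ‖x‖ < (k : ℝ) / 2 := not_le.1 hx
    have : 2 / (k : ℝ) * ‖x‖ ≤ 1 := by
      rw [div_mul_eq_mul_div, div_le_one hk0]
      linarith
    exact max_eq_left ((min_le_left _ _).trans (by linarith))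
  · intro x hx
    have hx' : (k : ℝ) ≤ ‖x‖ := hx
    have : 2 ≤ 2 / (k : ℝ) * ‖x‖ := by
      rw [div_mul_eq_mul_div, le_div_iff₀ hk0]
      linarith
    rw [outerCutoff, min_eq_right (by linarith), max_eq_right zero_le_one]
  · rw [add_le_add_iff_left]
    calc _ = _ := ?_
      _ ≤ ε / 3 + ε / 3 + ε / 3 := add_le_add (add_le_add hMε.le hδε.le) hkε.le
      _ = ε := by ring
    ring

end

theorem proposition2p2 (n : ℕ) (hn : 3 ≤ n) (R C ν : ℝ) (hC : 0 < C) (hν : 0 < ν)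
    (b c : EuclideanSpace ℝ (Fin n) → ℝ) :
    ∃ α : ℕ → ℝ, Tendsto α atTop (𝓝 0) ∧
      ∀ (F : EuclideanSpace ℝ (Fin n) → ℝ → ℝ) (q p T : ℝ) (u : ℝ → H1 n),
        GrowthCondition F C → DissipativeCondition F ν q p b c →
        IsSolution F T u → (∀ t ∈ Icc 0 T, ‖u t‖ ≤ R) →
        ∀ t ∈ Icc 0 T, ∀ k : ℕ,
          ∫ x in {x : EuclideanSpace ℝ (Fin n) | (k : ℝ) ≤ ‖x‖}, |(u t).fn x| ^ 2 ≤
            R ^ 2 * Real.exp (-2 * ν * t) + α k := by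
  -- `α k` is the infimum of all errors admissible at `k` for every `F`, `q`, `p`, `T`, `u` at once.
  -- The infimum is itself admissible, and the bounds for each `ε` say that it tends to `0`.
  let Q (k : ℕ) : Set ℝ := {ε | 0 ≤ ε ∧ ∀ (F : EuclideanSpace ℝ (Fin n) → ℝ → ℝ) (q p T : ℝ)
    (u : ℝ → H1 n), GrowthCondition F C → DissipativeCondition F ν q p b c →
    IsSolution F T u → (∀ t ∈ Icc 0 T, ‖u t‖ ≤ R) → ∀ t ∈ Icc 0 T,
      ∫ x in {x : EuclideanSpace ℝ (Fin n) | (k : ℝ) ≤ ‖x‖}, |(u t).fn x| ^ 2 ≤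
        R ^ 2 * Real.exp (-2 * ν * t) + ε}
  have hbdd (k : ℕ) : BddBelow (Q k) := ⟨0, fun ε h => h.1⟩
  have hne (k : ℕ) : (Q k).Nonempty := by
    -- The whole `L²` mass is at most `R ^ 2`, so this error is always admissible.
    refine ⟨R ^ 2, sq_nonneg R, fun F q p T u _ _ _ hR t ht => ?_⟩
    calc _ ≤ ∫ x, |(u t).fn x| ^ 2 := by
          refine setIntegral_le_integral ?_ (Eventually.of_forall fun x => by positivity)
          simpa only [sq_abs] using L2_integrable_sq (u t).fn
      _ = ‖(u t).fn‖ ^ 2 := by simp only [sq_abs, L2_norm_sq_eq]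
      _ ≤ R ^ 2 := by
          have := (u t).norm_fn_le.trans (hR t ht)
          gcongr
      _ ≤ _ := by
          have : 0 ≤ R ^ 2 * Real.exp (-2 * ν * t) := by positivity
          linarith
  refine ⟨fun k => sInf (Q k), ?_, fun F q p T u hF hD hu hR t ht k => ?_⟩
  · rw [Metric.tendsto_atTop]
    intro ε hε
    obtain ⟨k₀, hk₀⟩ := exists_tail_bound hn R hC.le hν b c (half_pos hε)
    refine ⟨k₀, fun k hk => ?_⟩
    have h1 : sInf (Q k) ≤ ε / 2 := csInf_le (hbdd k) ⟨by positivity, hk₀ k hk⟩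
    have h2 : 0 ≤ sInf (Q k) := le_csInf (hne k) fun ε h => h.1
    rw [Real.dist_eq, sub_zero, abs_of_nonneg h2]
    linarith
  · have := le_csInf (hne k) fun ε h => sub_le_iff_le_add'.2 (h.2 F q p T u hF hD hu hR t ht)
    linarith
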